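/- Setting. Consider a concurrent game with a finite state set $V$, an initial state $v_0\in V$, agents $\Omega=\{0,\dots,k-1\}$, finite action sets $A_0,\dots,A_{k-1}$, decisions $D=A_0\times\cdots\times A_{k-1}$, a transition function $\tau:V\times D\to V$, an integer discount factor $\gamma>1$ and a reward function $\mathcal W:V\times D\to\mathbb Z^k$. A (pure) strategy of Agent $i$ is a function $(V\times D)^*\times V\to A_i$; a strategy profile $\pi$ determines a unique play $\rho_\pi=(v_0,d_0),(v_1,d_1),\dots$. The cumulative reward of Agent $i$ on a play is $R_i(\rho)=\sum_{j\ge 0}\mathcal W(v_j,d_j)[i]\,\gamma^{-j}$. Agent $i$ has a multi-satisficing goal: a relation $\mathsf R_i\in\{<,>,\le,\ge\}$ and a finite nondecreasing sequence $T_i$ of $n_i$ rational thresholds. Her payoff on $\rho$ is the number of thresholds $t$ in $T_i$ such that $R_i(\rho)\mathrel{\mathsf R_i}t$. Let $W$ assign to each agent $i$ a payoff $W_i\in\{0,\dots,n_i\}$. A $W$-NE is a strategy profile $\pi$ such that no agent can strictly increase her payoff by changing only her own strategy, and such that the payoff of each agent $i$ on $\rho_\pi$ is $W_i$. Comparators.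 Let $\mu_i=\max_{v,d}|\mathcal W(v,d)[i]|$. A comparator for Agent $i$ and a threshold $t$ is a complete deterministic finite Büchi automaton over $\{-\mu_i,\dots,\mu_i\}$ that accepts exactly the words $w$ with $\sum_j w_j\gamma^{-j}\mathrel{\mathsf R_i}t$, and that is a safety automaton (the only rejecting state is a sink) if $\mathsf R_i\in\{\le,\ge\}$ and a co-safety automaton (the only accepting state is a sink) if $\mathsf R_i\in\{<,>\}$. Order the thresholds of Agent $i$ as $t_i^1,\dots,t_i^{n_i}$ from the easiest to the hardest to meet (increasingly for $>,\ge$ and decreasingly for $<,\le$). Given one comparator for each agent and threshold, consider for each $i$ with $W_i>0$ the comparator for $t_i^{W_i}$, specified to accept, and for each $i$ with $W_i<n_i$ the comparator $M_i$ for $t_i^{W_i+1}$, specified not to accept. The automaton $A_W$. This Büchi automaton has alphabet $D$. Its states consist of a game state, a state of each of these comparators, and two sets $S_1,S_2$ of these comparators. Initially the game state is $v_0$, the comparators are in their initial states, $S_1$ is the set of the co-safety comparators specified to accept, and $S_2$ is the set of the safety comparators specified not to accept. Reading $d$ in game state $v$, it moves to the game state $\tau(v,d)$, moves each comparator of each agent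 $i$ on the letter $\mathcal W(v,d)[i]$, and removes from $S_1$ the comparators whose new state is accepting and from $S_2$ those whose new state is rejecting; the transition is undefined if a safety comparator specified to accept gets into a rejecting state or a co-safety comparator specified not to accept gets into an accepting state. The accepting states are those with $S_1=S_2=\emptyset$. Deviation games. For each agent $j$ with $W_j<n_j$, let $G_j$ be the two-agent turn-based game in which, at a position $(v,q)$ with $v\in V$ and $q$ a state of $M_j$, Agent 0 chooses $d\in D$ and moves to $(v,q,d)$, where Agent 1 chooses a decision $d'$ that agrees with $d$ except possibly in the action of Agent $j$ and moves to $(\tau(v,d'),q')$, where $q'$ is the state that $M_j$ reaches from $q$ on the letter $\mathcal W(v,d')[j]$. If $M_j$ is a co-safety automaton, Agent 0 wins a play iff no accepting state of $M_j$ ever occurs; if it is a safety automaton, Agent 0 wins iff a rejecting state of $M_j$ occurs. Agent 1 wins the other plays. Let $\mathsf{Win}_1(G_j)$ be the set of positions from which Agent 1 has a winning strategy. The automaton $A'_W$ is the restriction of $A_W$ to the states such that $(v,q_j)\notin\mathsf{Win}_1(G_j)$ for all $j$ with $W_j<n_j$, where $v$ is the game state and $q_j$ is the state of $M_j$; moreover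 its transition from such a state on $d$ is undefined if $(v,q_j,d)\in\mathsf{Win}_1(G_j)$ for some $j$ with $W_j<n_j$. If the initial state of $A_W$ is not among these states, $A'_W$ accepts no word. Theorem. Comparators exist for all agents and thresholds, and for every choice of them the language of $A'_W$ is nonempty if and only if the game has a $W$-NE. -/

import Mathlib

open Filter

namespace MultiSat

/-! ### Automata on infinite words -/

/-- A (nondeterministic) Büchi automaton over the alphabet `Alph`, with finitely many states and
one initial state. -/
structure Buchi (Alph : Type*) where
  State : Type*
  finite : Finite State
  start : State
  trans : State → Alph → State → Prop
  accept : Set State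

/-- `r` is a run of `M` over the infinite word `w`. -/
def Buchi.IsRun {Alph : Type*} (M : Buchi Alph) (w : ℕ → Alph) (r : ℕ → M.State) : Prop :=
  r 0 = M.start ∧ ∀ n, M.trans (r n) (w n) (r (n + 1))

/-- `M` accepts `w`: over `w` there is a run that visits some accepting state infinitely often. -/
def Buchi.Accepts {Alph : Type*} (M : Buchi Alph) (w : ℕ → Alph) : Prop :=
  ∃ r, M.IsRun w r ∧ ∃ q ∈ M.accept, ∃ᶠ n in atTop, r n = q

/-- The language of a Büchi automaton. -/
def Buchi.language {Alph : Type*} (M : Buchi Alph) : Set (ℕ → Alph) :=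
  {w | M.Accepts w}

/-- A deterministic Büchi automaton with a total transition function. -/
structure DetBuchi (Alph : Type*) where
  State : Type
  finite : Finite State
  start : State
  next : State → Alph → State
  accept : Set State

/-- A deterministic Büchi automaton as a Büchi automaton. -/
def DetBuchi.toBuchi {Alph : Type*} (M : DetBuchi Alph) : Buchi Alph where
  State := M.State
  finite := M.finite
  start := M.start
  trans q a q' := M.next q a = q'
  accept := M.accept

/-- A safety automaton: the only rejecting state is a sink. -/
def DetBuchi.IsSafety {Alph : Type*} (M : DetBuchi Alph) : Prop :=
  ∃ s : M.State, M.accept = {s}ᶜ ∧ ∀ a, M.next s a = s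

/-- A co-safety automaton: the only accepting state is a sink. -/
def DetBuchi.IsCoSafety {Alph : Type*} (M : DetBuchi Alph) : Prop :=
  ∃ s : M.State, M.accept = {s} ∧ ∀ a, M.next s a = s

/-! ### Relations, thresholds and comparators -/

/-- The comparison relations `<`, `>`, `≤`, `≥`. -/
inductive Rel where
  | lt | gt | le | ge

/-- `r.Holds x t` says that `x r t`. -/
def Rel.Holds : Rel → ℝ → ℝ → Prop
  | .lt, x, t => x < t
  | .gt, x, t => x > t
  | .le, x, t => x ≤ t
  | .ge, x, t => x ≥ t

/-- The relations whose comparators are safety automata; for the others they are co-safety. -/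
def Rel.IsSafety : Rel → Prop
  | .le | .ge => True
  | .lt | .gt => False

/-- The relations that are harder to meet for larger thresholds. -/
def Rel.isUpward : Rel → Bool
  | .gt | .ge => true
  | .lt | .le => false

/-- The weights `-μ, …, μ`, the input alphabet of a comparator. -/
abbrev Weight (μ : ℕ) : Type := Set.Icc (-(μ : ℤ)) (μ : ℤ)

/-- The discounted sum `∑ w_j / γ^j` of a sequence of integers. -/
noncomputable def discountedSum (γ : ℕ) (w : ℕ → ℤ) : ℝ :=
  ∑' j : ℕ, (w j : ℝ) * (1 / (γ : ℝ) ^ j)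

/-- `M` is a comparator automaton for the discounted sum with discount factor `γ`, upper bound `μ`,
relation `r` and threshold `t`: it is of the safety or co-safety kind, according to `r`, and it
accepts exactly the weight sequences whose discounted sum is in relation `r` to `t`. -/
structure IsComparator (γ μ : ℕ) (r : Rel) (t : ℚ) (M : DetBuchi (Weight μ)) : Prop where
  safety : r.IsSafety → M.IsSafety
  coSafety : ¬ r.IsSafety → M.IsCoSafety
  accepts_iff : ∀ w : ℕ → Weight μ,
    w ∈ M.toBuchi.language ↔ r.Holds (discountedSum γ fun n => (w n : ℤ)) (t : ℝ)

/-- A multi-satisficing goal: a relation and a finite monotone sequence of rational thresholds. -/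
structure Goal where
  rel : Rel
  size : ℕ
  threshold : Fin size → ℚ
  monotone : Monotone threshold

/-- The payoff for a cumulative reward `x`: the number of thresholds that are met. -/
noncomputable def Goal.payoff (α : Goal) (x : ℝ) : ℕ :=
  Nat.card {m : Fin α.size // α.rel.Holds x (α.threshold m : ℝ)}

/-- The index of the threshold that is met `(m + 1)`-st when payoffs increase one by one: thresholds
are met in increasing order for `>` and `≥`, and in decreasing order for `<` and `≤`. -/
def Goal.nth (α : Goal) (m : Fin α.size) : Fin α.size :=
  if α.rel.isUpward then m else m.rev

/-! ### Two-agent turn-based games with a reachability or safety condition -/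

/-- The two kinds of winning conditions. -/
inductive Objective where
  | reachability | safety

/-- A two-agent turn-based game: Agent 0 owns `P₀`, Agent 1 owns `P₁`. The winning condition for
Agent 0 is to visit `target` (reachability), or never to leave it (safety); Agent 1 has the
negated goal. -/
structure TurnGame (P₀ P₁ : Type*) where
  edge : P₀ ⊕ P₁ → P₀ ⊕ P₁ → Prop
  objective : Objective
  target : Set (P₀ ⊕ P₁)

namespace TurnGame

variable {P₀ P₁ : Type*}

/-- `x` is a position where Agent `a` moves. -/
def Owns (a : Fin 2) (x : P₀ ⊕ P₁) : Prop :=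
  if a = 0 then x.isLeft = true else x.isRight = true

/-- Agent `a` wins the infinite play `p`. -/
def Wins (H : TurnGame P₀ P₁) (a : Fin 2) (p : ℕ → P₀ ⊕ P₁) : Prop :=
  let zeroWins : Prop := match H.objective with
    | .reachability => ∃ n, p n ∈ H.target
    | .safety => ∀ n, p n ∈ H.target
  if a = 0 then zeroWins else ¬ zeroWins

/-- `p` is an infinite play from the position `x`. -/
def IsPlayFrom (H : TurnGame P₀ P₁) (x : P₀ ⊕ P₁) (p : ℕ → P₀ ⊕ P₁) : Prop :=
  p 0 = x ∧ ∀ n, H.edge (p n) (p (n + 1))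

/-- A strategy maps the past positions and the current one to the next one; `s` is a strategy of
Agent `a` if it moves along edges at all positions of Agent `a`. -/
def IsStrategy (H : TurnGame P₀ P₁) (a : Fin 2)
    (s : List (P₀ ⊕ P₁) → P₀ ⊕ P₁ → P₀ ⊕ P₁) : Prop :=
  ∀ h x, Owns a x → H.edge x (s h x)

/-- Agent `a` follows the strategy `s` on the play `p`. -/
def Follows (a : Fin 2) (s : List (P₀ ⊕ P₁) → P₀ ⊕ P₁ → P₀ ⊕ P₁) (p : ℕ → P₀ ⊕ P₁) : Prop :=
  ∀ n, Owns a (p n) → p (n + 1) = s ((List.range n).map p) (p n)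

/-- The set of positions from which Agent `a` has a winning strategy. -/
def Win (H : TurnGame P₀ P₁) (a : Fin 2) : Set (P₀ ⊕ P₁) :=
  {x | ∃ s, H.IsStrategy a s ∧ ∀ p, H.IsPlayFrom x p → Follows a s p → H.Wins a p}

end TurnGame

/-! ### Multi-satisficing games -/

/-- The decisions: one action for each agent. -/
abbrev Decision {k : ℕ} (A : Fin k → Type*) := ∀ i, A i

/-- A concurrent discounted-sum game with agents `0, …, k - 1`, states `V` and action sets `A i`,
in which every agent has a multi-satisficing goal. -/
structure Game (V : Type*) {k : ℕ} (A : Fin k → Type*) where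
  init : V
  next : V → Decision A → V
  discount : ℕ
  one_lt_discount : 1 < discount
  reward : V → Decision A → Fin k → ℤ
  goal : Fin k → Goal

namespace Game

variable {V : Type*} {k : ℕ} {A : Fin k → Type*}

/-- A strategy of Agent `i`, from the past state-decision pairs and the current state. -/
abbrev Strategy (_G : Game V A) (i : Fin k) := List (V × Decision A) → V → A i

/-- A strategy profile. -/
abbrev Profile (G : Game V A) := ∀ i, G.Strategy i

/-- The history and the current state after `n` rounds under the profile `π`. -/
def position (G : Game V A) (π : G.Profile) : ℕ → List (V × Decision A) × V
  | 0 => ([], G.init)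
  | n + 1 =>
    let h := (G.position π n).1
    let v := (G.position π n).2
    let d : Decision A := fun i => π i h v
    (h ++ [(v, d)], G.next v d)

/-- The primary trace of `π`: the unique play that results from `π`. -/
def trace (G : Game V A) (π : G.Profile) (n : ℕ) : V × Decision A :=
  ((G.position π n).2, fun i => π i (G.position π n).1 (G.position π n).2)

/-- The cumulative reward of Agent `i` on a sequence of state-decision pairs. -/
noncomputable def cumulativeReward (G : Game V A) (i : Fin k) (ρ : ℕ → V × Decision A) : ℝ :=
  discountedSum G.discount fun j => G.reward (ρ j).1 (ρ j).2 i

/-- The payoff of Agent `i` on a sequence of state-decision pairs. -/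
noncomputable def payoff (G : Game V A) (i : Fin k) (ρ : ℕ → V × Decision A) : ℕ :=
  (G.goal i).payoff (G.cumulativeReward i ρ)

/-- A Nash equilibrium: no agent has a strategy that strictly increases her payoff when the others
keep theirs. -/
def IsNash (G : Game V A) (π : G.Profile) : Prop :=
  ∀ (i : Fin k) (s : G.Strategy i),
    ¬ G.payoff i (G.trace π) < G.payoff i (G.trace (Function.update π i s))

/-- Assignments of a possible payoff to each agent. -/
abbrev Assignment (G : Game V A) := ∀ i, Fin ((G.goal i).size + 1)

/-- A `W`-NE: a Nash equilibrium whose primary trace gives every agent the payoff stipulated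
by `W`. -/
def IsWNE (G : Game V A) (W : G.Assignment) (π : G.Profile) : Prop :=
  G.IsNash π ∧ ∀ i, G.payoff i (G.trace π) = W i

/-- The maximal magnitude of a reward of Agent `i`. -/
noncomputable def maxReward (G : Game V A) (i : Fin k) : ℕ :=
  ⨆ x : V × Decision A, (G.reward x.1 x.2 i).natAbs

theorem reward_mem [Finite V] [∀ i, Finite (A i)] (G : Game V A) (v : V) (d : Decision A)
    (i : Fin k) : G.reward v d i ∈ Set.Icc (-(G.maxReward i : ℤ)) (G.maxReward i : ℤ) := by
  have h : (G.reward v d i).natAbs ≤ G.maxReward i :=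
    le_ciSup (f := fun x : V × Decision A => (G.reward x.1 x.2 i).natAbs)
      (Set.finite_range _).bddAbove (v, d)
  constructor <;> omega

/-- The reward of Agent `i` as a letter for the comparators of Agent `i`. -/
noncomputable def weight [Finite V] [∀ i, Finite (A i)] (G : Game V A) (i : Fin k) (v : V)
    (d : Decision A) : Weight (G.maxReward i) :=
  ⟨G.reward v d i, G.reward_mem v d i⟩

/-- A choice of one comparator automaton for each agent and each of her thresholds. -/
structure Comparators (G : Game V A) where
  aut : ∀ i, Fin (G.goal i).size → DetBuchi (Weight (G.maxReward i))
  isComparator : ∀ i m, IsComparator G.discount (G.maxReward i) (G.goal i).rel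
    ((G.goal i).threshold m) (aut i m)

/-! ### The automaton for the stipulated payoffs -/

/-- The comparators that the automaton for `W` runs. For an agent with a positive payoff this is the
one (`Sum.inl`) for the last threshold that she has to meet, and for an agent without the maximal
payoff the one (`Sum.inr`) for the next threshold, which she must not meet. Together they describe
the interval of cumulative rewards with the payoff that `W` assigns. -/
abbrev Component (G : Game V A) (W : G.Assignment) :=
  {i : Fin k // 0 < (W i : ℕ)} ⊕ {i : Fin k // (W i : ℕ) < (G.goal i).size}

namespace Component

variable {G : Game V A} {W : G.Assignment}

/-- The agent of a component. -/
def agent : G.Component W → Fin k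
  | .inl i => i.1
  | .inr i => i.1

/-- The index of the threshold of a component. -/
def index : ∀ c : G.Component W, Fin (G.goal c.agent).size
  | .inl i => (G.goal i.1).nth ⟨W i.1 - 1, by have := i.2; have := (W i.1).isLt; omega⟩
  | .inr i => (G.goal i.1).nth ⟨W i.1, i.2⟩

/-- The component is specified to accept. -/
def MustAccept (c : G.Component W) : Prop := c.isLeft = true

/-- The comparator of the component is of the safety kind (and otherwise of the co-safety kind). -/
def IsSafety (c : G.Component W) : Prop := (G.goal c.agent).rel.IsSafety

/-- The comparator of a component. -/
def aut (C : G.Comparators) (c : G.Component W) : DetBuchi (Weight (G.maxReward c.agent)) :=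
  C.aut c.agent c.index

end Component

/-- States: a game state, a state of every comparator, the set of the co-safety comparators that
still have to accept, and the set of the safety comparators that still have to reject. -/
abbrev ProductState (G : Game V A) (W : G.Assignment) (C : G.Comparators) :=
  V × (∀ c : G.Component W, (c.aut C).State) × Set (G.Component W) × Set (G.Component W)

theorem finite_productState [Finite V] (G : Game V A) (W : G.Assignment) (C : G.Comparators) :
    Finite (G.ProductState W C) := by
  have : ∀ c : G.Component W, Finite (c.aut C).State := fun c => (c.aut C).finite
  infer_instance

/-- The automaton `A_W`, which reads sequences of decisions and checks that all agents get the
payoffs that `W` assigns. -/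
noncomputable def payoffAutomaton [Finite V] [∀ i, Finite (A i)] (G : Game V A) (W : G.Assignment)
    (C : G.Comparators) : Buchi (Decision A) where
  State := G.ProductState W C
  finite := G.finite_productState W C
  start := (G.init, fun c => (c.aut C).start,
    {c | c.MustAccept ∧ ¬ c.IsSafety}, {c | ¬ c.MustAccept ∧ c.IsSafety})
  trans := fun (v, q, S₁, S₂) d (v', q', S₁', S₂') =>
    v' = G.next v d ∧
    (∀ c, q' c = (c.aut C).next (q c) (G.weight c.agent v d)) ∧
    S₁' = {c ∈ S₁ | q' c ∉ (c.aut C).accept} ∧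
    S₂' = {c ∈ S₂ | q' c ∈ (c.aut C).accept} ∧
    (∀ c, c.MustAccept → c.IsSafety → q' c ∈ (c.aut C).accept) ∧
    (∀ c, ¬ c.MustAccept → ¬ c.IsSafety → q' c ∉ (c.aut C).accept)
  accept := {x | x.2.2.1 = ∅ ∧ x.2.2.2 = ∅}

/-! ### Deviations -/

open Classical in
/-- The deviation game of Agent `j` with respect to a comparator `M` for her relation. In `(v, q)`
Agent 0 proposes a decision `d`, and then Agent 1 may replace the action of Agent `j` in `d`.
Agent 0 tries to keep `M` from accepting: by avoiding accepting states if `M` is a co-safety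
automaton, by reaching a rejecting state if `M` is a safety automaton. -/
noncomputable def deviationGame [Finite V] [∀ i, Finite (A i)] (G : Game V A) (j : Fin k)
    (M : DetBuchi (Weight (G.maxReward j))) :
    TurnGame (V × M.State) (V × M.State × Decision A) where
  edge
    | .inl (v, q), .inr (v', q', _) => v' = v ∧ q' = q
    | .inr (v, q, d), .inl (v', q') => ∃ d' : Decision A, (∀ i, i ≠ j → d' i = d i) ∧
        G.next v d' = v' ∧ M.next q (G.weight j v d') = q'
    | _, _ => False
  objective := if (G.goal j).rel.IsSafety then .reachability else .safety
  target := {x | match x with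
    | .inl (_, q) => q ∉ M.accept
    | .inr (_, q, _) => q ∉ M.accept}

/-- The deviation game of an agent `j` without the maximal payoff, with respect to the comparator
for the next threshold, the one that would give her a higher payoff. -/
noncomputable def nextGame [Finite V] [∀ i, Finite (A i)] (G : Game V A) (W : G.Assignment)
    (C : G.Comparators) (j : {i : Fin k // (W i : ℕ) < (G.goal i).size}) :=
  G.deviationGame j.1 (Component.aut C (Sum.inr j : G.Component W))

/-- The states of `A'_W`: the states of `A_W` from which no agent without the maximal payoff can
force a higher payoff. -/
def safeStates [Finite V] [∀ i, Finite (A i)] (G : Game V A) (W : G.Assignment)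
    (C : G.Comparators) : Set (G.ProductState W C) :=
  {x | ∀ j : {i : Fin k // (W i : ℕ) < (G.goal i).size},
    Sum.inl (x.1, x.2.1 (Sum.inr j)) ∉ (G.nextGame W C j).Win 1}

/-- The automaton `A'_W`: the restriction of `A_W` to `safeStates` (transitions have to stay inside,
and if the initial state is outside then there is no run), without the transitions on a decision
from which some agent without the maximal payoff can force a higher payoff. -/
noncomputable def equilibriumAutomaton [Finite V] [∀ i, Finite (A i)] (G : Game V A)
    (W : G.Assignment) (C : G.Comparators) : Buchi (Decision A) where
  State := G.ProductState W C
  finite := G.finite_productState W C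
  start := (G.payoffAutomaton W C).start
  trans x d y :=
    x ∈ G.safeStates W C ∧ y ∈ G.safeStates W C ∧
    (G.payoffAutomaton W C).trans x d y ∧
    ∀ j : {i : Fin k // (W i : ℕ) < (G.goal i).size},
      Sum.inr (x.1, x.2.1 (Sum.inr j), d) ∉ (G.nextGame W C j).Win 1
  accept := (G.payoffAutomaton W C).accept

end Game

end MultiSat

/-!
Comparators. Reading `w`, an automaton can keep track of the gap between the partial sums of
`∑ w_j / γ ^ j` and the threshold `p / q`, scaled by `q γ ^ n`. This is an integer, and as the rest
of the sum contributes a bounded amount to it, the sum exceeds `p / q` exactly if the scaled gap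
exceeds a fixed bound at some time (`exists_le_gap_iff`). Beyond the bound the gap never returns, so
that it may be truncated there: finitely many states remain, and the top one is a sink. Changing the
sign of the weights and complementing the set of accepting states gives all four relations.

Equilibria. Thresholds are met in the order of `Goal.nth`, so that a play has the payoffs `W` exactly
if each comparator of the product accepts as specified (`forall_fulfils_iff`), and `A_W` accepts
exactly the decision sequences of such plays. The other ingredient is the positional determinacy of
reachability and safety games (`TurnGame.positional_determinacy`), in a form in which one positional
strategy of each agent is good for all positions.

* If `A'_W` accepts a word, let all agents follow it, and let the others answer the first deviation
  of an agent `j` by the positional strategy of Agent 0 in the deviation game of `j`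
  (`punishingProfile`). As the transitions of `A'_W` avoid the positions that Agent 1 wins, the
  comparator for the next threshold of `j` does not accept, and `j` does not improve her payoff.
* On the trace of a `W`-NE, the run of `A_W` never enters a position of a deviation game that
  Agent 1 wins: from there the deviating agent could react to the decisions of the others with the
  winning strategy of Agent 1 and increase her payoff (`IsWNE.inr_not_mem_win`). So the run is a run
  of `A'_W`.

Passing between strategies of the concurrent game and the deviation games relies on the comparators
being safety or co-safety automata: any tail of a run decides acceptance, so that it does not matter
that a deviation game starts in the middle of a play.
-/

open Filter

namespace MultiSat

/-! ### Deterministic automata with a sink -/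

theorem exists_frequently_eq_iff {S : Type*} [Finite S] (r : ℕ → S) (F : Set S) :
    (∃ q ∈ F, ∃ᶠ n in atTop, r n = q) ↔ ∃ᶠ n in atTop, r n ∈ F := by
  constructor
  · rintro ⟨q, hq, h⟩
    exact h.mono fun n hn => hn ▸ hq
  · intro h
    by_contra! hc
    refine h ?_
    have : ∀ᶠ n in atTop, ∀ q : S, q ∈ F → r n ≠ q := by
      rw [eventually_all]
      intro q
      by_cases hq : q ∈ F
      · filter_upwards [hc q hq] with n hn _ using hn
      · exact Eventually.of_forall fun n h => absurd h hq
    filter_upwards [this] with n hn hF using hn _ hF rfl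

namespace DetBuchi

variable {Alph : Type*}

/-- The unique run of a deterministic automaton over an infinite word. -/
def run (M : DetBuchi Alph) (w : ℕ → Alph) : ℕ → M.State
  | 0 => M.start
  | n + 1 => M.next (M.run w n) (w n)

/-- The state reached after a finite word. -/
def after (M : DetBuchi Alph) (h : List Alph) : M.State :=
  h.foldl M.next M.start

theorem after_range_map (M : DetBuchi Alph) (w : ℕ → Alph) (n : ℕ) :
    M.after ((List.range n).map w) = M.run w n := by
  induction n with
  | zero => rfl
  | succ n ih =>
    rw [List.range_succ, List.map_append, after, List.foldl_append]
    change List.foldl _ (M.after _) _ = _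
    rw [ih]
    rfl

theorem mem_language_iff (M : DetBuchi Alph) (w : ℕ → Alph) :
    w ∈ M.toBuchi.language ↔ ∃ᶠ n in atTop, M.run w n ∈ M.accept := by
  have := M.finite
  rw [← exists_frequently_eq_iff]
  constructor
  · rintro ⟨r, ⟨h0, hr⟩, h⟩
    have : r = M.run w := by
      funext n
      induction n with
      | zero => exact h0
      | succ n ih =>
        rw [← (show M.next (r n) (w n) = r (n + 1) from hr n), ih]
        rfl
    rwa [this] at h
  · intro h
    exact ⟨M.run w, ⟨rfl, fun _ => rfl⟩, h⟩

theorem run_eq_of_le (M : DetBuchi Alph) {s : M.State} (hs : ∀ a, M.next s a = s) (w : ℕ → Alph)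
    {m n : ℕ} (hmn : m ≤ n) (h : M.run w m = s) : M.run w n = s := by
  induction n, hmn using Nat.le_induction with
  | base => exact h
  | succ n _ ih => rw [run, ih, hs]

theorem IsSafety.mem_language_iff {M : DetBuchi Alph} (h : M.IsSafety) (w : ℕ → Alph) :
    w ∈ M.toBuchi.language ↔ ∀ n, M.run w n ∈ M.accept := by
  obtain ⟨s, hacc, hs⟩ := h
  rw [DetBuchi.mem_language_iff, hacc]
  constructor
  · intro hf n hn
    obtain ⟨m, hm, hm'⟩ := frequently_atTop.1 hf n
    exact hm' (M.run_eq_of_le hs w hm hn)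
  · intro h
    exact Frequently.of_forall h

theorem IsCoSafety.mem_language_iff {M : DetBuchi Alph} (h : M.IsCoSafety) (w : ℕ → Alph) :
    w ∈ M.toBuchi.language ↔ ∃ n, M.run w n ∈ M.accept := by
  obtain ⟨s, hacc, hs⟩ := h
  rw [DetBuchi.mem_language_iff, hacc]
  constructor
  · exact fun hf => hf.exists
  · rintro ⟨n, hn⟩
    exact frequently_atTop.2 fun m =>
      ⟨max m n, le_max_left _ _, M.run_eq_of_le hs w (le_max_right _ _) hn⟩

end DetBuchi

/-! ### Existence of comparators -/

/-- The discounted sum differs from its `n`-th partial sum by at most `μ γ / γ ^ n`. -/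
theorem abs_discountedSum_sub_le {γ μ : ℕ} (hγ : 1 < γ) {w : ℕ → ℤ} (hw : ∀ j, |w j| ≤ μ) (n : ℕ) :
    |discountedSum γ w - ∑ j ∈ Finset.range n, (w j : ℝ) * (1 / (γ : ℝ) ^ j)|
      ≤ (μ : ℝ) * γ / (γ : ℝ) ^ n := by
  have hγ' : (2 : ℝ) ≤ γ := by exact_mod_cast hγ
  have hw' : ∀ j, |(w j : ℝ)| ≤ μ := fun j => by exact_mod_cast hw j
  have hgeo : HasSum (fun j : ℕ => ((γ : ℝ)⁻¹) ^ j) (1 - (γ : ℝ)⁻¹)⁻¹ :=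
    hasSum_geometric_of_lt_one (by positivity) (inv_lt_one_of_one_lt₀ (by linarith))
  have hb : ∀ j, ‖(w j : ℝ) * (1 / (γ : ℝ) ^ j)‖ ≤ μ * ((γ : ℝ)⁻¹) ^ j := fun j => by
    rw [norm_mul, Real.norm_eq_abs, Real.norm_eq_abs, abs_of_nonneg (a := 1 / (γ : ℝ) ^ j)
      (by positivity), one_div, inv_pow]
    exact mul_le_mul_of_nonneg_right (hw' j) (by positivity)
  have hs : Summable fun j : ℕ => (w j : ℝ) * (1 / (γ : ℝ) ^ j) :=
    Summable.of_norm_bounded (hgeo.summable.mul_left _) hb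
  rw [discountedSum, ← hs.sum_add_tsum_nat_add n, add_sub_cancel_left]
  have hg2 : HasSum (fun j : ℕ => μ * ((γ : ℝ)⁻¹) ^ n * ((γ : ℝ)⁻¹) ^ j)
      (μ * ((γ : ℝ)⁻¹) ^ n * (1 - (γ : ℝ)⁻¹)⁻¹) := hgeo.mul_left _
  have h := tsum_of_norm_bounded (f := fun j => (w (j + n) : ℝ) * (1 / (γ : ℝ) ^ (j + n))) hg2
    fun j => (hb (j + n)).trans_eq (by rw [pow_add]; ring)
  rw [Real.norm_eq_abs] at h
  refine h.trans ?_
  have h1 : (1 - (γ : ℝ)⁻¹)⁻¹ ≤ γ := by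
    rw [inv_le_comm₀ _ (by linarith)]
    · have : (γ : ℝ)⁻¹ ≤ 2⁻¹ := inv_anti₀ (by norm_num) hγ'
      linarith
    · have : (γ : ℝ)⁻¹ ≤ 2⁻¹ := inv_anti₀ (by norm_num) hγ'
      linarith
  calc (μ : ℝ) * ((γ : ℝ)⁻¹) ^ n * (1 - (γ : ℝ)⁻¹)⁻¹ ≤ (μ : ℝ) * ((γ : ℝ)⁻¹) ^ n * γ :=
        mul_le_mul_of_nonneg_left h1 (by positivity)
    _ = (μ : ℝ) * γ / (γ : ℝ) ^ n := by rw [inv_pow]; ring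

theorem discountedSum_neg (γ : ℕ) (w : ℕ → ℤ) :
    discountedSum γ (fun j => -w j) = -discountedSum γ w := by
  simp [discountedSum, tsum_neg]

/-- The gap between the partial sums of `∑ w_j / γ ^ j` and `p / q`, scaled by `q γ ^ n` so that it
is an integer. -/
def gap (γ : ℕ) (p q : ℤ) (w : ℕ → ℤ) : ℕ → ℤ
  | 0 => -p
  | n + 1 => γ * (gap γ p q w n + q * w n)

theorem gap_eq {γ : ℕ} (hγ : 1 < γ) (p : ℤ) {q : ℤ} (hq : 0 < q) (w : ℕ → ℤ) (n : ℕ) :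
    (gap γ p q w n : ℝ) = q * (γ : ℝ) ^ n *
      (∑ j ∈ Finset.range n, (w j : ℝ) * (1 / (γ : ℝ) ^ j) - (p : ℝ) / q) := by
  have hγ' : (γ : ℝ) ≠ 0 := by positivity
  have hq' : (q : ℝ) ≠ 0 := by exact_mod_cast hq.ne'
  induction n with
  | zero => simp [gap]; field_simp
  | succ n ih =>
    rw [gap, Finset.sum_range_succ]
    push_cast
    rw [ih]
    field_simp
    ring

/-- Since the tail of the sum contributes at most `γ q μ` to the scaled gap, the sum exceeds `p / q`
exactly if the scaled gap exceeds this bound at some time. -/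
theorem exists_le_gap_iff {γ μ : ℕ} (hγ : 1 < γ) (p : ℤ) {q : ℤ} (hq : 0 < q) {w : ℕ → ℤ}
    (hw : ∀ j, |w j| ≤ μ) :
    (∃ n, γ * q * μ + 1 ≤ gap γ p q w n) ↔ (p : ℝ) / q < discountedSum γ w := by
  have hγ' : (1 : ℝ) < γ := by exact_mod_cast hγ
  have hq' : (0 : ℝ) < q := by exact_mod_cast hq
  have key : ∀ n, |q * (γ : ℝ) ^ n * (discountedSum γ w - (p : ℝ) / q) - gap γ p q w n|
      ≤ γ * q * μ := by
    intro n
    have h := abs_discountedSum_sub_le hγ hw n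
    have hpos : (0 : ℝ) < q * (γ : ℝ) ^ n := by positivity
    rw [gap_eq hγ p hq, ← mul_sub, abs_mul, abs_of_pos hpos, sub_sub_sub_cancel_right]
    refine (mul_le_mul_of_nonneg_left h hpos.le).trans_eq ?_
    field_simp
  constructor
  · rintro ⟨n, hn⟩
    have hn' : (γ * q * μ + 1 : ℝ) ≤ gap γ p q w n := by exact_mod_cast hn
    have h := (abs_le.1 (key n)).1
    have hpos : 0 < q * (γ : ℝ) ^ n * (discountedSum γ w - (p : ℝ) / q) := by linarith
    have := (pos_iff_pos_of_mul_pos hpos).1 (by positivity)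
    linarith
  · intro h
    have hd : 0 < q * (discountedSum γ w - (p : ℝ) / q) := mul_pos hq' (sub_pos.2 h)
    obtain ⟨n, hn⟩ := pow_unbounded_of_one_lt
      ((2 * (γ * q * μ) + 1) / (q * (discountedSum γ w - (p : ℝ) / q))) hγ'
    rw [div_lt_iff₀ hd] at hn
    refine ⟨n, ?_⟩
    have h' := (abs_le.1 (key n)).2
    have : (γ * q * μ + 1 : ℝ) ≤ gap γ p q w n := by
      have e : q * (γ : ℝ) ^ n * (discountedSum γ w - (p : ℝ) / q)
        = (γ : ℝ) ^ n * (q * (discountedSum γ w - (p : ℝ) / q)) := by ring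
      linarith
    exact_mod_cast this

/-- Truncation of an integer to the interval from `-m` to `m`. -/
def clamp (m : ℕ) (z : ℤ) : Set.Icc (-(m : ℤ)) (m : ℤ) :=
  ⟨max (-(m : ℤ)) (min z m), le_max_left _ _, max_le (by omega) (min_le_right _ _)⟩

/-- The automaton that computes the scaled gap of the sequence `ε w_j`, truncated at the bound beyond
which the gap does not return. The set of accepting states is a parameter. -/
def gapAutomaton (γ μ : ℕ) (ε p : ℤ) (q : ℕ)
    (F : Set (Set.Icc (-((γ * q * μ + 1 : ℕ) : ℤ)) ((γ * q * μ + 1 : ℕ) : ℤ))) :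
    DetBuchi (Weight μ) where
  State := Set.Icc (-((γ * q * μ + 1 : ℕ) : ℤ)) ((γ * q * μ + 1 : ℕ) : ℤ)
  finite := Set.finite_Icc _ _
  start := clamp _ (-p)
  next z w := clamp _ (γ * (z + q * (ε * w)))
  accept := F

section gapAutomaton

variable {γ μ : ℕ} (hγ : 1 < γ) {ε : ℤ} (hε : |ε| = 1) (p : ℤ) {q : ℕ}

include hε in
theorem abs_sign_mul_weight_le (w : Weight μ) : |ε * w| ≤ μ := by
  rw [abs_mul, hε, one_mul]
  exact abs_le.2 w.2

include hγ in
/-- A gap beyond the bound stays there, as does one below its negative, so that truncation commutes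
with the update of the gap. -/
theorem clamp_update_clamp (z : ℤ) {x : ℤ} (hx : |x| ≤ μ) :
    clamp (γ * q * μ + 1) (γ * (clamp (γ * q * μ + 1) z + q * x))
      = clamp (γ * q * μ + 1) (γ * (z + q * x)) := by
  have hγ' : (2 : ℤ) ≤ γ := by exact_mod_cast hγ
  have hq : (0 : ℤ) ≤ q := by positivity
  obtain ⟨hx1, hx2⟩ := abs_le.1 hx
  have hN : ((γ * q * μ + 1 : ℕ) : ℤ) = γ * (q * μ) + 1 := by push_cast; ring
  have h1 : -(q * μ : ℤ) ≤ q * x := by nlinarith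
  have h2 : (q * x : ℤ) ≤ q * μ := by nlinarith
  have h0 : (0 : ℤ) ≤ q * μ := by positivity
  have hn : (0 : ℤ) ≤ γ * (q * μ) := by positivity
  -- The bound `γ q μ + 1` is at most `γ (y + q x)` for every `y` that is at least this bound.
  have up : ∀ y : ℤ, γ * (q * μ) + 1 ≤ y → γ * (q * μ) + 1 ≤ γ * (y + q * x) := fun y hy => by
    nlinarith
  have down : ∀ y : ℤ, y ≤ -(γ * (q * μ) + 1) → γ * (y + q * x) ≤ -(γ * (q * μ) + 1) :=
    fun y hy => by nlinarith
  apply Subtype.ext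
  simp only [clamp, hN]
  set B : ℤ := γ * (q * μ) + 1
  rcases le_total z (-B) with hz | hz
  · have e : max (-B) (min z B) = -B := by omega
    rw [e]
    have a := down _ hz
    have b := down _ le_rfl
    omega
  · rcases le_total B z with hz' | hz'
    · have e : max (-B) (min z B) = B := by omega
      rw [e]
      have a := up _ hz'
      have b := up _ le_rfl
      omega
    · have e : max (-B) (min z B) = z := by omega
      rw [e]

include hγ hε in
theorem run_gapAutomaton (F) (w : ℕ → Weight μ) (n : ℕ) :
    (gapAutomaton γ μ ε p q F).run w n
      = clamp (γ * q * μ + 1) (gap γ p q (fun j => ε * (w j : ℤ)) n) := by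
  induction n with
  | zero => rfl
  | succ n ih =>
    rw [DetBuchi.run, ih]
    exact clamp_update_clamp hγ _ (abs_sign_mul_weight_le hε (w n))

include hγ hε in
theorem next_top_gapAutomaton (F) (w : Weight μ) :
    (gapAutomaton γ μ ε p q F).next (clamp _ (γ * q * μ + 1 : ℕ)) w
      = clamp _ (γ * q * μ + 1 : ℕ) := by
  refine (clamp_update_clamp hγ _ (abs_sign_mul_weight_le hε w)).trans ?_
  have hγ' : (2 : ℤ) ≤ γ := by exact_mod_cast hγ
  have h1 : -(q * μ : ℤ) ≤ q * (ε * w) := by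
    nlinarith [(abs_le.1 (abs_sign_mul_weight_le hε w)).1]
  have h0 : (0 : ℤ) ≤ q * μ := by positivity
  have hn : (0 : ℤ) ≤ γ * (q * μ) := by positivity
  have hN : ((γ * q * μ + 1 : ℕ) : ℤ) = γ * (q * μ) + 1 := by push_cast; ring
  have : γ * (q * μ) + 1 ≤ γ * ((γ * (q * μ) + 1) + q * (ε * w)) := by nlinarith
  apply Subtype.ext
  simp only [clamp, hN]
  omega

include hγ hε in
theorem exists_run_gapAutomaton_eq_top_iff (hq : 0 < q) (F) (w : ℕ → Weight μ) :
    (∃ n, (gapAutomaton γ μ ε p q F).run w n = clamp _ (γ * q * μ + 1 : ℕ))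
      ↔ (p : ℝ) / q < discountedSum γ fun j => ε * (w j : ℤ) := by
  have h := exists_le_gap_iff hγ p (q := q) (by exact_mod_cast hq)
    (w := fun j => ε * (w j : ℤ)) fun j => abs_sign_mul_weight_le hε (w j)
  rw [Int.cast_natCast] at h
  rw [← h]
  refine exists_congr fun n => ?_
  rw [run_gapAutomaton hγ hε]
  refine Subtype.ext_iff.trans ?_
  simp only [clamp]
  have : (0 : ℤ) ≤ γ * q * μ := by positivity
  push_cast
  omega

include hγ hε in
theorem gapAutomaton_isCoSafety :
    (gapAutomaton γ μ ε p q {clamp _ (γ * q * μ + 1 : ℕ)}).IsCoSafety :=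
  ⟨_, rfl, next_top_gapAutomaton hγ hε p _⟩

include hγ hε in
theorem gapAutomaton_isSafety :
    (gapAutomaton γ μ ε p q {clamp _ (γ * q * μ + 1 : ℕ)}ᶜ).IsSafety :=
  ⟨_, rfl, next_top_gapAutomaton hγ hε p _⟩

include hγ hε in
theorem mem_language_gapAutomaton_coSafety (hq : 0 < q) (w : ℕ → Weight μ) :
    w ∈ (gapAutomaton γ μ ε p q {clamp _ (γ * q * μ + 1 : ℕ)}).toBuchi.language
      ↔ (p : ℝ) / q < discountedSum γ fun j => ε * (w j : ℤ) := by
  rw [(gapAutomaton_isCoSafety hγ hε p).mem_language_iff,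
    ← exists_run_gapAutomaton_eq_top_iff hγ hε p hq]
  rfl

include hγ hε in
theorem mem_language_gapAutomaton_safety (hq : 0 < q) (w : ℕ → Weight μ) :
    w ∈ (gapAutomaton γ μ ε p q {clamp _ (γ * q * μ + 1 : ℕ)}ᶜ).toBuchi.language
      ↔ (discountedSum γ fun j => ε * (w j : ℤ)) ≤ (p : ℝ) / q := by
  rw [(gapAutomaton_isSafety hγ hε p).mem_language_iff, ← not_lt,
    ← exists_run_gapAutomaton_eq_top_iff hγ hε p hq, not_exists]
  rfl

end gapAutomaton

/-- For `<` and `≥`, the gap automaton runs on the negated weights and the negated threshold. -/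
theorem exists_isComparator {γ : ℕ} (hγ : 1 < γ) (μ : ℕ) (r : Rel) (t : ℚ) :
    ∃ M, IsComparator γ μ r t M := by
  have hpos : |(1 : ℤ)| = 1 := rfl
  have hneg : |(-1 : ℤ)| = 1 := rfl
  have hq : 0 < t.den := t.den_pos
  have ht : (t : ℝ) = t.num / t.den := by exact_mod_cast (Rat.num_div_den t).symm
  cases r with
  | lt =>
    refine ⟨gapAutomaton γ μ (-1) (-t.num) t.den _, fun h => h.elim,
      fun _ => gapAutomaton_isCoSafety hγ hneg _, fun w => ?_⟩
    rw [mem_language_gapAutomaton_coSafety hγ hneg _ hq]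
    simp [Rel.Holds, discountedSum_neg, ht, neg_div]
  | gt =>
    refine ⟨gapAutomaton γ μ 1 t.num t.den _, fun h => h.elim,
      fun _ => gapAutomaton_isCoSafety hγ hpos _, fun w => ?_⟩
    rw [mem_language_gapAutomaton_coSafety hγ hpos _ hq]
    simp [Rel.Holds, ht]
  | le =>
    refine ⟨gapAutomaton γ μ 1 t.num t.den _, fun _ => gapAutomaton_isSafety hγ hpos _,
      fun h => (h trivial).elim, fun w => ?_⟩
    rw [mem_language_gapAutomaton_safety hγ hpos _ hq]
    simp [Rel.Holds, ht]
  | ge =>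
    refine ⟨gapAutomaton γ μ (-1) (-t.num) t.den _, fun _ => gapAutomaton_isSafety hγ hneg _,
      fun h => (h trivial).elim, fun w => ?_⟩
    rw [mem_language_gapAutomaton_safety hγ hneg _ hq]
    simp [Rel.Holds, discountedSum_neg, ht, neg_div]

/-! ### Positional determinacy of reachability and safety games -/

namespace TurnGame

variable {P₀ P₁ : Type*}

/-- The positions from which Agent `a` can force a visit to `T` within `n` steps. -/
def attr (H : TurnGame P₀ P₁) (a : Fin 2) (T : Set (P₀ ⊕ P₁)) : ℕ → Set (P₀ ⊕ P₁)
  | 0 => T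
  | n + 1 => H.attr a T n ∪ ({x | Owns a x ∧ ∃ y ∈ H.attr a T n, H.edge x y} ∪
      {x | ¬ Owns a x ∧ ∀ y, H.edge x y → y ∈ H.attr a T n})

theorem monotone_attr (H : TurnGame P₀ P₁) (a : Fin 2) (T : Set (P₀ ⊕ P₁)) :
    Monotone (H.attr a T) :=
  monotone_nat_of_le_succ fun _ => Set.subset_union_left

/-- The positions from which Agent `a` can force a visit to `T`. -/
def attractor (H : TurnGame P₀ P₁) (a : Fin 2) (T : Set (P₀ ⊕ P₁)) : Set (P₀ ⊕ P₁) :=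
  ⋃ n, H.attr a T n

theorem owns_zero_iff (x : P₀ ⊕ P₁) : Owns 0 x ↔ ¬ Owns 1 x := by
  cases x <;> simp [Owns]

theorem wins_one_iff_not_wins_zero (H : TurnGame P₀ P₁) (p : ℕ → P₀ ⊕ P₁) :
    H.Wins 1 p ↔ ¬ H.Wins 0 p := by
  simp [Wins]

/-- The attracting agent moves to a successor of least rank. -/
theorem exists_positional_attractor (H : TurnGame P₀ P₁) (htot : ∀ x, ∃ y, H.edge x y) (a : Fin 2)
    (T : Set (P₀ ⊕ P₁)) :
    ∃ f : P₀ ⊕ P₁ → P₀ ⊕ P₁, (∀ x, H.edge x (f x)) ∧ ∀ x ∈ H.attractor a T, ∀ p,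
      H.IsPlayFrom x p → (∀ n, Owns a (p n) → p (n + 1) = f (p n)) → ∃ n, p n ∈ T := by
  classical
  have hex : ∀ x, ∃ y, H.edge x y ∧
      ∀ n, (∃ z ∈ H.attr a T n, H.edge x z) → y ∈ H.attr a T n := by
    intro x
    by_cases h : ∃ n, ∃ z ∈ H.attr a T n, H.edge x z
    · obtain ⟨z, hz, hxz⟩ := Nat.find_spec h
      exact ⟨z, hxz, fun n hn => H.monotone_attr a T (Nat.find_min' h hn) hz⟩
    · obtain ⟨y, hy⟩ := htot x
      exact ⟨y, hy, fun n hn => (h ⟨n, hn⟩).elim⟩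
  choose f hf hmin using hex
  refine ⟨f, hf, ?_⟩
  have key : ∀ r, ∀ p : ℕ → P₀ ⊕ P₁, (∀ n, H.edge (p n) (p (n + 1))) →
      (∀ n, Owns a (p n) → p (n + 1) = f (p n)) → ∀ n, p n ∈ H.attr a T r → ∃ m, p m ∈ T := by
    intro r p hp hfol
    induction r with
    | zero => exact fun n hn => ⟨n, hn⟩
    | succ r ih =>
      rintro n (hn | ⟨hown, hy⟩ | ⟨-, hall⟩)
      · exact ih n hn
      · exact ih (n + 1) (by rw [hfol n hown]; exact hmin _ _ hy)
      · exact ih (n + 1) (hall _ (hp n))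
  rintro x hx p ⟨h0, hp⟩ hfol
  obtain ⟨r, hr⟩ := Set.mem_iUnion.1 hx
  exact key r p hp hfol 0 (h0 ▸ hr)

/-- The opponent stays outside of the attractor. -/
theorem exists_positional_avoid [Finite P₀] [Finite P₁] (H : TurnGame P₀ P₁)
    (htot : ∀ x, ∃ y, H.edge x y) (a : Fin 2) (T : Set (P₀ ⊕ P₁)) :
    ∃ f : P₀ ⊕ P₁ → P₀ ⊕ P₁, (∀ x, H.edge x (f x)) ∧ ∀ x ∉ H.attractor a T, ∀ p,
      H.IsPlayFrom x p → (∀ n, ¬ Owns a (p n) → p (n + 1) = f (p n)) → ∀ n, p n ∉ T := by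
  have hex : ∀ x, ∃ y, H.edge x y ∧
      (¬ Owns a x → x ∉ H.attractor a T → y ∉ H.attractor a T) := by
    intro x
    by_cases h : ∃ y, H.edge x y ∧ y ∉ H.attractor a T
    · obtain ⟨y, hy, hy'⟩ := h
      exact ⟨y, hy, fun _ _ => hy'⟩
    · push Not at h
      obtain ⟨y, hy⟩ := htot x
      refine ⟨y, hy, fun hown hx => (hx ?_).elim⟩
      -- As there are finitely many positions, the ranks of the successors are bounded.
      have hr : ∀ z, ∃ r, z ∈ H.attractor a T → z ∈ H.attr a T r := by
        intro z
        by_cases hz : z ∈ H.attractor a T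
        · obtain ⟨r, hr⟩ := Set.mem_iUnion.1 hz
          exact ⟨r, fun _ => hr⟩
        · exact ⟨0, fun h => (hz h).elim⟩
      choose rank hrank using hr
      obtain ⟨N, hN⟩ := (Set.finite_range rank).bddAbove
      exact Set.mem_iUnion.2 ⟨N + 1, Or.inr <| Or.inr ⟨hown, fun z hz =>
        H.monotone_attr a T (hN ⟨z, rfl⟩) (hrank z (h z hz))⟩⟩
  choose f hf hout using hex
  refine ⟨f, hf, ?_⟩
  rintro x hx p ⟨h0, hp⟩ hfol
  have hstay : ∀ n, p n ∉ H.attractor a T := by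
    intro n
    induction n with
    | zero => rwa [h0]
    | succ n ih =>
      by_cases hown : Owns a (p n)
      · intro hmem
        obtain ⟨r, hr⟩ := Set.mem_iUnion.1 hmem
        exact ih (Set.mem_iUnion.2 ⟨r + 1, Or.inr <| Or.inl ⟨hown, _, hr, hp n⟩⟩)
      · rw [hfol n hown]
        exact hout _ hown ih
  exact fun n hn => hstay n (Set.mem_iUnion.2 ⟨0, hn⟩)

/-- Two strategies, of which that of Agent 0 is positional, have a common play. -/
theorem exists_play (H : TurnGame P₀ P₁) {f : P₀ ⊕ P₁ → P₀ ⊕ P₁} (hf : ∀ x, H.edge x (f x))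
    {s : List (P₀ ⊕ P₁) → P₀ ⊕ P₁ → P₀ ⊕ P₁} (hs : H.IsStrategy 1 s) (x : P₀ ⊕ P₁) :
    ∃ p, H.IsPlayFrom x p ∧ (∀ n, Owns 0 (p n) → p (n + 1) = f (p n)) ∧ Follows 1 s p := by
  classical
  let step : List (P₀ ⊕ P₁) × (P₀ ⊕ P₁) → List (P₀ ⊕ P₁) × (P₀ ⊕ P₁) := fun c =>
    (c.1 ++ [c.2], if Owns 1 c.2 then s c.1 c.2 else f c.2)
  let c : ℕ → List (P₀ ⊕ P₁) × (P₀ ⊕ P₁) := fun n => step^[n] ([], x)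
  have hc : ∀ n, c (n + 1) = step (c n) := fun n => Function.iterate_succ_apply' _ _ _
  have hlist : ∀ n, (c n).1 = (List.range n).map fun m => (c m).2 := by
    intro n
    induction n with
    | zero => rfl
    | succ n ih => rw [hc, List.range_succ, List.map_append, ← ih]; rfl
  refine ⟨fun n => (c n).2, ⟨rfl, fun n => ?_⟩, fun n hn => ?_, fun n hn => ?_⟩
  · simp only [hc, step]
    split_ifs with h
    · exact hs _ _ h
    · exact hf _
  · simp only [hc, step]
    rw [if_neg ((owns_zero_iff _).1 hn)]
  · simp only [← hlist]
    simp only [hc, step]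
    rw [if_pos hn]

/-- Positional determinacy: Agent 1 has a positional strategy that wins from all positions from which
she has any winning strategy, and Agent 0 has one that wins from all other positions. -/
theorem positional_determinacy [Finite P₀] [Finite P₁] (H : TurnGame P₀ P₁)
    (htot : ∀ x, ∃ y, H.edge x y) :
    ∃ f₀ f₁ : P₀ ⊕ P₁ → P₀ ⊕ P₁, (∀ x, H.edge x (f₀ x)) ∧ (∀ x, H.edge x (f₁ x)) ∧
      (∀ x ∉ H.Win 1, ∀ p, H.IsPlayFrom x p →
        (∀ n, Owns 0 (p n) → p (n + 1) = f₀ (p n)) → H.Wins 0 p) ∧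
      (∀ x ∈ H.Win 1, ∀ p, H.IsPlayFrom x p →
        (∀ n, Owns 1 (p n) → p (n + 1) = f₁ (p n)) → H.Wins 1 p) := by
  suffices h : ∃ f₀ f₁ : P₀ ⊕ P₁ → P₀ ⊕ P₁, ∃ R : Set (P₀ ⊕ P₁),
      (∀ x, H.edge x (f₀ x)) ∧ (∀ x, H.edge x (f₁ x)) ∧
      (∀ x ∈ R, ∀ p, H.IsPlayFrom x p →
        (∀ n, Owns 0 (p n) → p (n + 1) = f₀ (p n)) → H.Wins 0 p) ∧
      (∀ x ∉ R, ∀ p, H.IsPlayFrom x p →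
        (∀ n, Owns 1 (p n) → p (n + 1) = f₁ (p n)) → H.Wins 1 p) by
    obtain ⟨f₀, f₁, R, h₀, h₁, hw₀, hw₁⟩ := h
    have hR : ∀ x, x ∈ R ↔ x ∉ H.Win 1 := by
      intro x
      constructor
      · rintro hx ⟨s, hs, hwin⟩
        obtain ⟨p, hp, hp₀, hp₁⟩ := H.exists_play h₀ hs x
        have a := hw₀ x hx p hp hp₀
        have b := hwin p hp hp₁
        exact (H.wins_one_iff_not_wins_zero p).1 b a
      · intro hx
        by_contra hxR
        exact hx ⟨fun _ => f₁, fun _ x _ => h₁ x, fun p hp hfol => hw₁ x hxR p hp hfol⟩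
    exact ⟨f₀, f₁, h₀, h₁, fun x hx => hw₀ x ((hR x).2 hx),
      fun x hx => hw₁ x fun h => (hR x).1 h hx⟩
  rcases hobj : H.objective with _ | _
  · obtain ⟨f₀, h₀, hw₀⟩ := H.exists_positional_attractor htot 0 H.target
    obtain ⟨f₁, h₁, hw₁⟩ := H.exists_positional_avoid htot 0 H.target
    refine ⟨f₀, f₁, H.attractor 0 H.target, h₀, h₁, fun x hx p hp hfol => ?_,
      fun x hx p hp hfol => ?_⟩
    · simpa [Wins, hobj] using hw₀ x hx p hp hfol
    · simpa [Wins, hobj] using hw₁ x hx p hp fun n hn =>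
        hfol n (by rwa [owns_zero_iff, not_not] at hn)
  · obtain ⟨f₁, h₁, hw₁⟩ := H.exists_positional_attractor htot 1 H.targetᶜ
    obtain ⟨f₀, h₀, hw₀⟩ := H.exists_positional_avoid htot 1 H.targetᶜ
    refine ⟨f₀, f₁, (H.attractor 1 H.targetᶜ)ᶜ, h₀, h₁, fun x hx p hp hfol => ?_,
      fun x hx p hp hfol => ?_⟩
    · simpa [Wins, hobj] using hw₀ x hx p hp fun n hn => hfol n ((owns_zero_iff _).2 hn)
    · simpa [Wins, hobj] using hw₁ x (not_not.1 hx) p hp hfol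

end TurnGame

/-! ### Payoffs and thresholds -/

namespace Goal

theorem payoff_le_size (α : Goal) (x : ℝ) : α.payoff x ≤ α.size := by
  classical
  rw [payoff]
  simpa using Finite.card_subtype_le fun m : Fin α.size => α.rel.Holds x (α.threshold m : ℝ)

/-- A threshold that comes later in the order of `Goal.nth` is harder to meet. -/
theorem holds_nth_of_le (α : Goal) (x : ℝ) {m m' : Fin α.size} (h : m ≤ m')
    (hx : α.rel.Holds x (α.threshold (α.nth m') : ℝ)) :
    α.rel.Holds x (α.threshold (α.nth m) : ℝ) := by
  have hup : (α.threshold m : ℝ) ≤ α.threshold m' := by exact_mod_cast α.monotone h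
  have hdown : (α.threshold m'.rev : ℝ) ≤ α.threshold m.rev := by
    exact_mod_cast α.monotone (Fin.rev_le_rev.2 h)
  unfold nth at hx ⊢
  cases hr : α.rel <;> simp [hr, Rel.isUpward, Rel.Holds] at hx ⊢ <;> linarith

theorem holds_nth_iff (α : Goal) (x : ℝ) (m : Fin α.size) :
    α.rel.Holds x (α.threshold (α.nth m) : ℝ) ↔ (m : ℕ) < α.payoff x := by
  classical
  have hinv : Function.Involutive α.nth := fun m => by unfold nth; split_ifs <;> simp
  have hcard : α.payoff x
      = (Finset.univ.filter fun m => α.rel.Holds x (α.threshold (α.nth m) : ℝ)).card := by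
    rw [payoff, Nat.card_eq_fintype_card, ← Fintype.card_subtype]
    exact Fintype.card_congr (hinv.toPerm.subtypeEquiv fun m => by
      simp [hinv m])
  rw [hcard]
  constructor
  · intro h
    have : (Finset.Iic m).card ≤ (Finset.univ.filter fun m =>
        α.rel.Holds x (α.threshold (α.nth m) : ℝ)).card :=
      Finset.card_le_card fun m' hm' => by
        simpa using α.holds_nth_of_le x (Finset.mem_Iic.1 hm') h
    rw [Fin.card_Iic] at this
    omega
  · intro h
    by_contra hn
    have : (Finset.univ.filter fun m =>
        α.rel.Holds x (α.threshold (α.nth m) : ℝ)).card ≤ (Finset.Iio m).card :=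
      Finset.card_le_card fun m' hm' => by
        rw [Finset.mem_Iio]
        by_contra hle
        exact hn (α.holds_nth_of_le x (not_lt.1 hle) (by simpa using hm'))
    rw [Fin.card_Iio] at this
    omega

end Goal

namespace Game

variable {V : Type*} {k : ℕ} {A : Fin k → Type*}

/-! ### Plays and traces -/

/-- A sequence of state-decision pairs that starts in the initial state and follows the transition
function. -/
def IsPlay (G : Game V A) (ρ : ℕ → V × Decision A) : Prop :=
  (ρ 0).1 = G.init ∧ ∀ n, (ρ (n + 1)).1 = G.next (ρ n).1 (ρ n).2

theorem isPlay_trace (G : Game V A) (π : G.Profile) : G.IsPlay (G.trace π) :=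
  ⟨rfl, fun _ => rfl⟩

theorem position_fst (G : Game V A) (π : G.Profile) (n : ℕ) :
    (G.position π n).1 = (List.range n).map (G.trace π) := by
  induction n with
  | zero => rfl
  | succ n ih => rw [List.range_succ, List.map_append, ← ih]; rfl

theorem trace_snd (G : Game V A) (π : G.Profile) (n : ℕ) (i : Fin k) :
    (G.trace π n).2 i = π i ((List.range n).map (G.trace π)) (G.trace π n).1 := by
  rw [← position_fst]
  rfl

theorem map_range_congr {S : Type*} {f g : ℕ → S} {n : ℕ} (h : ∀ m < n, f m = g m) :
    (List.range n).map f = (List.range n).map g :=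
  List.map_congr_left fun m hm => h m (List.mem_range.1 hm)

theorem IsPlay.fst_eq {G : Game V A} {ρ ρ' : ℕ → V × Decision A} (h : G.IsPlay ρ)
    (h' : G.IsPlay ρ') {n : ℕ} (heq : ∀ m < n, ρ m = ρ' m) : (ρ n).1 = (ρ' n).1 := by
  cases n with
  | zero => rw [h.1, h'.1]
  | succ n => rw [h.2, h'.2, heq n n.lt_succ_self]

theorem IsPlay.eq_of_snd_eq {G : Game V A} {ρ ρ' : ℕ → V × Decision A} (h : G.IsPlay ρ)
    (h' : G.IsPlay ρ') {n : ℕ}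
    (hs : ∀ m < n, (∀ l < m, ρ l = ρ' l) → (ρ m).1 = (ρ' m).1 → (ρ m).2 = (ρ' m).2) :
    ∀ m < n, ρ m = ρ' m := by
  intro m
  induction m using Nat.strong_induction_on with
  | _ m ih =>
    intro hm
    have heq : ∀ l < m, ρ l = ρ' l := fun l hl => ih l hl (hl.trans hm)
    exact Prod.ext (h.fst_eq h' heq) (hs m hm heq (h.fst_eq h' heq))

/-! ### The deviation game -/

section Deviation

variable [Finite V] [∀ i, Finite (A i)] (G : Game V A) (j : Fin k)
  (M : DetBuchi (Weight (G.maxReward j)))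

/-- The rewards of an agent along a sequence of state-decision pairs, as letters for her
comparators. -/
noncomputable def weights (ρ : ℕ → V × Decision A) (n : ℕ) : Weight (G.maxReward j) :=
  G.weight j (ρ n).1 (ρ n).2

/-- The states of the automaton `M` along a sequence of state-decision pairs. -/
noncomputable def runOn (ρ : ℕ → V × Decision A) (n : ℕ) : M.State :=
  M.run (G.weights j ρ) n

/-- The state of the automaton `M` after a history. -/
noncomputable def afterHistory (h : List (V × Decision A)) : M.State :=
  M.after (h.map fun x => G.weight j x.1 x.2)

theorem afterHistory_range (ρ : ℕ → V × Decision A) (n : ℕ) :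
    G.afterHistory j M ((List.range n).map ρ) = G.runOn j M ρ n := by
  rw [afterHistory, List.map_map]
  exact M.after_range_map (G.weights j ρ) n

theorem runOn_congr {ρ ρ' : ℕ → V × Decision A} {n : ℕ} (h : ∀ m < n, ρ m = ρ' m) :
    G.runOn j M ρ n = G.runOn j M ρ' n := by
  rw [← afterHistory_range, ← afterHistory_range, map_range_congr h]

/-- In a run of rounds in which Agent 0 proposes `d t` and Agent 1 replaces this by `e t`, the
positions form a play of the deviation game, with those of Agent 1 at even times. -/
theorem exists_deviationGame_play {v : ℕ → V} {q : ℕ → M.State} {d e : ℕ → Decision A}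
    (hde : ∀ t, ∀ i, i ≠ j → e t i = d t i) (hv : ∀ t, v (t + 1) = G.next (v t) (e t))
    (hq : ∀ t, q (t + 1) = M.next (q t) (G.weight j (v t) (e t))) :
    ∃ p, (G.deviationGame j M).IsPlayFrom (Sum.inr (v 0, q 0, d 0)) p ∧
      (∀ t, p (2 * t) = Sum.inr (v t, q t, d t)) ∧
      (∀ t, p (2 * t + 1) = Sum.inl (v (t + 1), q (t + 1))) := by
  let p : ℕ → (V × M.State) ⊕ (V × M.State × Decision A) := fun n =>
    if n % 2 = 0 then Sum.inr (v (n / 2), q (n / 2), d (n / 2))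
    else Sum.inl (v (n / 2 + 1), q (n / 2 + 1))
  have h0 : ∀ t, p (2 * t) = Sum.inr (v t, q t, d t) := fun t => by
    simp [p]
  have h1 : ∀ t, p (2 * t + 1) = Sum.inl (v (t + 1), q (t + 1)) := fun t => by
    have e1 : (2 * t + 1) % 2 = 1 := by omega
    have e2 : (2 * t + 1) / 2 = t := by omega
    simp [p, e1, e2]
  refine ⟨p, ⟨h0 0, fun n => ?_⟩, h0, h1⟩
  obtain ⟨t, rfl | rfl⟩ := n.even_or_odd'
  · rw [h0, h1]
    exact ⟨e t, hde t, (hv t).symm, (hq t).symm⟩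
  · rw [h1, show 2 * t + 1 + 1 = 2 * (t + 1) by ring, h0]
    exact ⟨rfl, rfl⟩

open Classical in
theorem wins_zero_iff {p : ℕ → (V × M.State) ⊕ (V × M.State × Decision A)} {v : ℕ → V}
    {q : ℕ → M.State} {d : ℕ → Decision A} (h0 : ∀ t, p (2 * t) = Sum.inr (v t, q t, d t))
    (h1 : ∀ t, p (2 * t + 1) = Sum.inl (v (t + 1), q (t + 1))) :
    (G.deviationGame j M).Wins 0 p ↔
      if (G.goal j).rel.IsSafety then ∃ t, q t ∉ M.accept else ∀ t, q t ∉ M.accept := by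
  have hodd : ∀ t, p (2 * t + 1) ∈ (G.deviationGame j M).target ↔ q (t + 1) ∉ M.accept :=
    fun t => by rw [h1]; rfl
  have heven : ∀ t, p (2 * t) ∈ (G.deviationGame j M).target ↔ q t ∉ M.accept :=
    fun t => by rw [h0]; rfl
  by_cases hs : (G.goal j).rel.IsSafety
  · have hobj : (G.deviationGame j M).objective = .reachability := if_pos hs
    simp only [TurnGame.Wins, hobj, if_true, if_pos hs]
    constructor
    · rintro ⟨n, hn⟩
      obtain ⟨t, rfl | rfl⟩ := n.even_or_odd'
      · exact ⟨t, (heven t).1 hn⟩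
      · exact ⟨t + 1, (hodd t).1 hn⟩
    · rintro ⟨t, ht⟩
      exact ⟨2 * t, (heven t).2 ht⟩
  · have hobj : (G.deviationGame j M).objective = .safety := if_neg hs
    simp only [TurnGame.Wins, hobj, if_true, if_neg hs]
    constructor
    · exact fun h t => (heven t).1 (h _)
    · intro h n
      obtain ⟨t, rfl | rfl⟩ := n.even_or_odd'
      · exact (heven t).2 (h t)
      · exact (hodd t).2 (h _)

open Classical in
/-- Since rejection by a safety automaton and acceptance by a co-safety automaton are permanent, any
tail of the run decides acceptance. -/
theorem not_mem_language_iff {G : Game V A} {j : Fin k} {M : DetBuchi (Weight (G.maxReward j))}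
    {t : ℚ} (hM : IsComparator G.discount (G.maxReward j) (G.goal j).rel t M)
    (ρ : ℕ → V × Decision A) (n : ℕ) :
    G.weights j ρ ∉ M.toBuchi.language ↔
      if (G.goal j).rel.IsSafety then ∃ t, G.runOn j M ρ (n + t) ∉ M.accept
      else ∀ t, G.runOn j M ρ (n + t) ∉ M.accept := by
  split_ifs with hs
  · rw [(hM.safety hs).mem_language_iff, not_forall]
    obtain ⟨s, hacc, hsink⟩ := hM.safety hs
    constructor
    · rintro ⟨m, hm⟩
      simp only [hacc, Set.mem_compl_iff, not_not, Set.mem_singleton_iff] at hm ⊢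
      exact ⟨m, M.run_eq_of_le hsink _ (Nat.le_add_left _ _) hm⟩
    · exact fun ⟨t, ht⟩ => ⟨_, ht⟩
  · rw [(hM.coSafety hs).mem_language_iff, not_exists]
    obtain ⟨s, hacc, hsink⟩ := hM.coSafety hs
    constructor
    · exact fun h t => h _
    · intro h m hm
      simp only [hacc, Set.mem_singleton_iff] at h hm
      exact h m (M.run_eq_of_le hsink _ (Nat.le_add_left _ _) hm)

theorem deviationGame_total [Nonempty (Decision A)]
    (x : (V × M.State) ⊕ (V × M.State × Decision A)) : ∃ y, (G.deviationGame j M).edge x y := by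
  rcases x with ⟨v, q⟩ | ⟨v, q, d⟩
  · exact ⟨Sum.inr (v, q, Classical.arbitrary _), rfl, rfl⟩
  · exact ⟨Sum.inl (_, _), d, fun _ _ => rfl, rfl, rfl⟩

variable {j M} in
theorem deviationGame_edge_inl {v : V} {q : M.State} {y}
    (h : (G.deviationGame j M).edge (Sum.inl (v, q)) y) : ∃ d, y = Sum.inr (v, q, d) := by
  rcases y with ⟨v', q'⟩ | ⟨v', q', d⟩
  · exact h.elim
  · obtain ⟨rfl, rfl⟩ := h
    exact ⟨d, rfl⟩

variable {j M} in
theorem deviationGame_edge_inr {v : V} {q : M.State} {d : Decision A} {y}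
    (h : (G.deviationGame j M).edge (Sum.inr (v, q, d)) y) : ∃ a : A j,
      y = Sum.inl (G.next v (Function.update d j a),
        M.next q (G.weight j v (Function.update d j a))) := by
  rcases y with ⟨v', q'⟩ | ⟨v', q', d⟩
  · obtain ⟨d', hd', rfl, rfl⟩ := h
    refine ⟨d' j, ?_⟩
    have : Function.update d j (d' j) = d' := by
      funext i
      by_cases hi : i = j
      · subst hi; simp
      · simp [hi, hd' i hi]
    rw [this]
  · exact h.elim

/-- A positional strategy by which the other agents punish Agent `j`: once she has deviated from a
decision after which she cannot force acceptance by `M`, they prevent it. -/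
theorem exists_punishment [Nonempty (Decision A)] {t : ℚ}
    (hM : IsComparator G.discount (G.maxReward j) (G.goal j).rel t M) :
    ∃ σ : V → M.State → Decision A, ∀ (ρ : ℕ → V × Decision A) (n : ℕ) (d : Decision A),
      (∀ m, (ρ (m + 1)).1 = G.next (ρ m).1 (ρ m).2) →
      Sum.inr ((ρ n).1, G.runOn j M ρ n, d) ∉ (G.deviationGame j M).Win 1 →
      (∀ i, i ≠ j → (ρ n).2 i = d i) →
      (∀ m, n < m → ∀ i, i ≠ j → (ρ m).2 i = σ (ρ m).1 (G.runOn j M ρ m) i) →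
      G.weights j ρ ∉ M.toBuchi.language := by
  have := M.finite
  obtain ⟨f₀, -, h₀, -, hw, -⟩ :=
    (G.deviationGame j M).positional_determinacy (G.deviationGame_total j M)
  choose σ hσ using fun (v : V) (q : M.State) => G.deviationGame_edge_inl (h₀ (Sum.inl (v, q)))
  refine ⟨σ, fun ρ n d hρ hd hn hm => ?_⟩
  let ds : ℕ → Decision A := fun t =>
    if t = 0 then d else σ (ρ (n + t)).1 (G.runOn j M ρ (n + t))
  obtain ⟨p, hp, hp0, hp1⟩ := G.exists_deviationGame_play j M (v := fun t => (ρ (n + t)).1)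
    (q := fun t => G.runOn j M ρ (n + t)) (d := ds) (e := fun t => (ρ (n + t)).2)
    (fun t i hi => by
      rcases t.eq_zero_or_pos with rfl | ht
      · exact hn i hi
      · simp only [ds, ht.ne', if_false]
        exact hm _ (by omega) i hi)
    (fun t => hρ (n + t)) (fun t => rfl)
  have hwin := hw _ hd p hp fun m hown => by
    obtain ⟨t, rfl | rfl⟩ := m.even_or_odd'
    · rw [hp0] at hown
      simp [TurnGame.Owns] at hown
    · rw [hp1, hσ, show 2 * t + 1 + 1 = 2 * (t + 1) by ring, hp0]
      simp [ds]
  rw [G.wins_zero_iff j M hp0 hp1] at hwin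
  exact (not_mem_language_iff hM ρ n).2 hwin

/-- A positional reaction to the proposals of the other agents by which Agent `j` forces acceptance
by `M` from all positions from which this is possible. -/
theorem exists_profitable_reaction [Nonempty (Decision A)] {t : ℚ}
    (hM : IsComparator G.discount (G.maxReward j) (G.goal j).rel t M) :
    ∃ g : V → M.State → Decision A → A j, ∀ (ρ : ℕ → V × Decision A) (n : ℕ)
      (d : ℕ → Decision A), (∀ m, (ρ (m + 1)).1 = G.next (ρ m).1 (ρ m).2) →
      Sum.inr ((ρ n).1, G.runOn j M ρ n, d n) ∈ (G.deviationGame j M).Win 1 →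
      (∀ m, n ≤ m →
        (ρ m).2 = Function.update (d m) j (g (ρ m).1 (G.runOn j M ρ m) (d m))) →
      G.weights j ρ ∈ M.toBuchi.language := by
  have := M.finite
  obtain ⟨-, f₁, -, h₁, -, hw⟩ :=
    (G.deviationGame j M).positional_determinacy (G.deviationGame_total j M)
  choose g hg using fun (v : V) (q : M.State) (d : Decision A) =>
    G.deviationGame_edge_inr (h₁ (Sum.inr (v, q, d)))
  refine ⟨g, fun ρ n d hρ hd hm => ?_⟩
  obtain ⟨p, hp, hp0, hp1⟩ := G.exists_deviationGame_play j M (v := fun t => (ρ (n + t)).1)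
    (q := fun t => G.runOn j M ρ (n + t)) (d := fun t => d (n + t)) (e := fun t => (ρ (n + t)).2)
    (fun t i hi => by rw [hm _ (Nat.le_add_right _ _), Function.update_of_ne hi])
    (fun t => hρ (n + t)) (fun t => rfl)
  have hwin := hw _ hd p hp fun m hown => by
    obtain ⟨t, rfl | rfl⟩ := m.even_or_odd'
    · rw [hp1, hp0, hg, ← hm _ (Nat.le_add_right _ _)]
      exact congrArg Sum.inl (Prod.ext (hρ (n + t)) rfl)
    · rw [hp1] at hown
      simp [TurnGame.Owns] at hown
  rw [TurnGame.wins_one_iff_not_wins_zero, G.wins_zero_iff j M hp0 hp1] at hwin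
  by_contra hc
  exact hwin ((not_mem_language_iff hM ρ n).1 hc)

variable {j M} in
/-- If Agent `j` can force acceptance from a position of Agent 0, then also after any proposal: she
plays as if the proposal had been the first move. -/
theorem inr_mem_win_of_inl_mem_win {v : V} {q : M.State}
    (h : Sum.inl (v, q) ∈ (G.deviationGame j M).Win 1) (d : Decision A) :
    Sum.inr (v, q, d) ∈ (G.deviationGame j M).Win 1 := by
  obtain ⟨s, hs, hwin⟩ := h
  refine ⟨fun h x => s (Sum.inl (v, q) :: h) x, fun h x hx => hs _ x hx, fun p hp hfol => ?_⟩
  let p' : ℕ → (V × M.State) ⊕ (V × M.State × Decision A) := fun n =>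
    Nat.casesOn n (Sum.inl (v, q)) p
  have hplay : (G.deviationGame j M).IsPlayFrom (Sum.inl (v, q)) p' := by
    refine ⟨rfl, fun n => ?_⟩
    cases n with
    | zero =>
      change (G.deviationGame j M).edge (Sum.inl (v, q)) (p 0)
      rw [hp.1]
      exact ⟨rfl, rfl⟩
    | succ n => exact hp.2 n
  have hfol' : TurnGame.Follows 1 s p' := by
    intro n hn
    cases n with
    | zero => simp [p', TurnGame.Owns] at hn
    | succ n =>
      rw [List.range_succ_eq_map, List.map_cons, List.map_map]
      exact hfol n hn
  have hw := hwin p' hplay hfol'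
  rw [TurnGame.wins_one_iff_not_wins_zero] at hw ⊢
  refine fun hc => hw ?_
  have htarget : p 0 ∈ (G.deviationGame j M).target ↔ p' 0 ∈ (G.deviationGame j M).target := by
    rw [hp.1]
    rfl
  simp only [TurnGame.Wins, if_true] at hc ⊢
  cases hobj : (G.deviationGame j M).objective <;> simp only [hobj] at hc ⊢
  · obtain ⟨n, hn⟩ := hc
    exact ⟨n + 1, hn⟩
  · intro n
    cases n with
    | zero => exact htarget.1 (hc 0)
    | succ n => exact hc n

end Deviation

/-! ### Runs of the automaton for the stipulated payoffs -/

section Runs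

variable [Finite V] [∀ i, Finite (A i)] (G : Game V A) (W : G.Assignment) (C : G.Comparators)

/-- The comparator of the component `c` accepts its input on `ρ` exactly if it is specified to. -/
def Fulfils (ρ : ℕ → V × Decision A) (c : G.Component W) : Prop :=
  G.weights c.agent ρ ∈ (c.aut C).toBuchi.language ↔ c.MustAccept

variable {G} in
theorem Comparators.mem_language_iff (C : G.Comparators) (ρ : ℕ → V × Decision A) (i : Fin k)
    (m : Fin (G.goal i).size) :
    G.weights i ρ ∈ (C.aut i ((G.goal i).nth m)).toBuchi.language ↔ (m : ℕ) < G.payoff i ρ := by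
  rw [(C.isComparator i _).accepts_iff]
  exact (G.goal i).holds_nth_iff _ m

theorem forall_fulfils_iff (ρ : ℕ → V × Decision A) :
    (∀ c : G.Component W, G.Fulfils W C ρ c) ↔ ∀ i, G.payoff i ρ = W i := by
  have hl : ∀ i : {i : Fin k // 0 < (W i : ℕ)},
      G.Fulfils W C ρ (Sum.inl i) ↔ (W i.1 : ℕ) - 1 < G.payoff i.1 ρ := fun i =>
    (iff_true_right (rfl : Component.MustAccept (Sum.inl i : G.Component W))).trans
      (C.mem_language_iff ρ i.1 ⟨W i.1 - 1, by have := i.2; have := (W i.1).isLt; omega⟩)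
  have hr : ∀ i : {i : Fin k // (W i : ℕ) < (G.goal i).size},
      G.Fulfils W C ρ (Sum.inr i) ↔ ¬ (W i.1 : ℕ) < G.payoff i.1 ρ := fun i =>
    (iff_false_right (by simp [Component.MustAccept])).trans
      (not_congr (C.mem_language_iff ρ i.1 ⟨W i.1, i.2⟩))
  constructor
  · intro h i
    have hle : G.payoff i ρ ≤ (G.goal i).size := (G.goal i).payoff_le_size _
    apply le_antisymm
    · by_cases hi : (W i : ℕ) < (G.goal i).size
      · exact not_lt.1 ((hr ⟨i, hi⟩).1 (h _))
      · omega
    · by_cases hi : 0 < (W i : ℕ)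
      · have := (hl ⟨i, hi⟩).1 (h _)
        change (W i : ℕ) - 1 < G.payoff i ρ at this
        omega
      · omega
  · rintro h (i | i)
    · rw [hl, h]
      have := i.2
      omega
    · rw [hr, h]
      exact lt_irrefl _

/-- The state that the automaton `A_W` reaches after `n` rounds of `ρ`, if its run does not end
before. -/
noncomputable def productRun (ρ : ℕ → V × Decision A) (n : ℕ) : G.ProductState W C :=
  ((ρ n).1, fun c => G.runOn c.agent (c.aut C) ρ n,
    {c | (c.MustAccept ∧ ¬ c.IsSafety) ∧
      ∀ m < n, G.runOn c.agent (c.aut C) ρ (m + 1) ∉ (c.aut C).accept},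
    {c | (¬ c.MustAccept ∧ c.IsSafety) ∧
      ∀ m < n, G.runOn c.agent (c.aut C) ρ (m + 1) ∈ (c.aut C).accept})

/-- The condition on the states of the comparators after `n` rounds without which the transition is
undefined. -/
def Admissible (ρ : ℕ → V × Decision A) (n : ℕ) : Prop :=
  (∀ c : G.Component W, c.MustAccept → c.IsSafety →
    G.runOn c.agent (c.aut C) ρ n ∈ (c.aut C).accept) ∧
  (∀ c : G.Component W, ¬ c.MustAccept → ¬ c.IsSafety →
    G.runOn c.agent (c.aut C) ρ n ∉ (c.aut C).accept)

variable {G} in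
theorem productRun_zero {ρ : ℕ → V × Decision A} (hρ : G.IsPlay ρ) :
    G.productRun W C ρ 0 = (G.payoffAutomaton W C).start := by
  simp only [productRun, payoffAutomaton, hρ.1, Nat.not_lt_zero, false_imp_iff, implies_true,
    and_true]
  rfl

variable {G} in
theorem trans_productRun_iff {ρ : ℕ → V × Decision A} (hρ : G.IsPlay ρ) (n : ℕ)
    (y : G.ProductState W C) :
    (G.payoffAutomaton W C).trans (G.productRun W C ρ n) (ρ n).2 y ↔
      y = G.productRun W C ρ (n + 1) ∧ G.Admissible W C ρ (n + 1) := by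
  obtain ⟨v, q, S₁, S₂⟩ := y
  have h₁ : ∀ P : ℕ → Prop, (∀ m < n + 1, P m) ↔ (∀ m < n, P m) ∧ P n := fun P =>
    ⟨fun h => ⟨fun m hm => h m (by omega), h n (by omega)⟩, fun h m hm => by
      rcases Nat.lt_succ_iff_lt_or_eq.1 hm with hm | rfl
      exacts [h.1 m hm, h.2]⟩
  constructor
  · rintro ⟨rfl, hq, hS₁, hS₂, ha, hb⟩
    obtain rfl : q = fun c : G.Component W => G.runOn c.agent (c.aut C) ρ (n + 1) := funext hq
    refine ⟨?_, ha, hb⟩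
    simp only [productRun, Prod.mk.injEq]
    refine ⟨(hρ.2 n).symm, trivial, ?_, ?_⟩
    · rw [hS₁]
      ext c
      exact (and_assoc).trans (and_congr_right fun _ => (h₁ _).symm)
    · rw [hS₂]
      ext c
      exact (and_assoc).trans (and_congr_right fun _ => (h₁ _).symm)
  · rintro ⟨h, ha, hb⟩
    simp only [productRun, Prod.mk.injEq] at h
    obtain ⟨rfl, rfl, rfl, rfl⟩ := h
    refine ⟨hρ.2 n, fun c => rfl, ?_, ?_, ha, hb⟩
    · ext c
      exact (and_congr_right fun _ => h₁ _).trans and_assoc.symm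
    · ext c
      exact (and_congr_right fun _ => h₁ _).trans and_assoc.symm

variable {G} in
theorem exists_play_of_isRun {d : ℕ → Decision A} {r : ℕ → G.ProductState W C}
    (hr : (G.payoffAutomaton W C).IsRun d r) :
    ∃ ρ, G.IsPlay ρ ∧ (∀ n, (ρ n).2 = d n) ∧ (∀ n, r n = G.productRun W C ρ n) ∧
      ∀ n, G.Admissible W C ρ (n + 1) := by
  let ρ : ℕ → V × Decision A := fun n => ((r n).1, d n)
  have hρ : G.IsPlay ρ := ⟨congrArg Prod.fst hr.1, fun n => (hr.2 n).1⟩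
  have hstep : ∀ n, r n = G.productRun W C ρ n → r (n + 1) = G.productRun W C ρ (n + 1) ∧
      G.Admissible W C ρ (n + 1) := fun n hn => by
    have := hr.2 n
    rw [hn] at this
    exact (trans_productRun_iff W C hρ n _).1 this
  have heq : ∀ n, r n = G.productRun W C ρ n := by
    intro n
    induction n with
    | zero => rw [productRun_zero W C hρ]; exact hr.1
    | succ n ih => exact (hstep n ih).1
  exact ⟨ρ, hρ, fun n => rfl, heq, fun n => (hstep n (heq n)).2⟩

variable {G W} in
theorem Component.mem_language_iff (c : G.Component W) (ρ : ℕ → V × Decision A) :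
    (c.IsSafety → (G.weights c.agent ρ ∈ (c.aut C).toBuchi.language ↔
      ∀ n, G.runOn c.agent (c.aut C) ρ (n + 1) ∈ (c.aut C).accept)) ∧
    (¬ c.IsSafety → (G.weights c.agent ρ ∈ (c.aut C).toBuchi.language ↔
      ∃ n, G.runOn c.agent (c.aut C) ρ (n + 1) ∈ (c.aut C).accept)) := by
  have h := not_mem_language_iff (C.isComparator c.agent c.index) ρ 1
  simp only [add_comm 1] at h
  constructor <;> intro hs
  · rw [if_pos (show (G.goal c.agent).rel.IsSafety from hs), ← not_forall] at h
    exact not_iff_not.1 h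
  · rw [if_neg (show ¬ (G.goal c.agent).rel.IsSafety from hs), ← not_exists] at h
    exact not_iff_not.1 h

theorem forall_fulfils_of_admissible {ρ : ℕ → V × Decision A}
    (ha : ∀ n, G.Admissible W C ρ (n + 1))
    (hacc : ∃ n, G.productRun W C ρ n ∈ (G.payoffAutomaton W C).accept) (c : G.Component W) :
    G.Fulfils W C ρ c := by
  obtain ⟨n, h₁, h₂⟩ := hacc
  obtain ⟨hsafe, hcosafe⟩ := c.mem_language_iff C ρ
  have h₁' := Set.eq_empty_iff_forall_notMem.1 h₁ c
  have h₂' := Set.eq_empty_iff_forall_notMem.1 h₂ c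
  simp only [productRun, Set.mem_ofPred_eq, not_and, not_forall, not_not] at h₁' h₂'
  by_cases hs : c.IsSafety <;> by_cases hm : c.MustAccept
  · exact iff_of_true ((hsafe hs).2 fun n => (ha n).1 c hm hs) hm
  · obtain ⟨m, -, hm'⟩ := h₂' ⟨hm, hs⟩
    exact iff_of_false (fun h => hm' ((hsafe hs).1 h m)) hm
  · obtain ⟨m, -, hm'⟩ := h₁' ⟨hm, hs⟩
    exact iff_of_true ((hcosafe hs).2 ⟨m, hm'⟩) hm
  · exact iff_of_false (fun h => by
      obtain ⟨m, hm'⟩ := (hcosafe hs).1 h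
      exact (ha m).2 c hm hs hm') hm

theorem admissible_of_forall_fulfils {ρ : ℕ → V × Decision A}
    (h : ∀ c : G.Component W, G.Fulfils W C ρ c) (n : ℕ) : G.Admissible W C ρ (n + 1) := by
  refine ⟨fun c hm hs => ?_, fun c hm hs hc => ?_⟩
  · exact ((c.mem_language_iff C ρ).1 hs).1 ((h c).2 hm) n
  · exact hm ((h c).1 (((c.mem_language_iff C ρ).2 hs).2 ⟨n, hc⟩))

/-- Every comparator in one of the two sets of pending comparators leaves it at some time, and there
are finitely many of them. -/
theorem eventually_accept_of_forall_fulfils {ρ : ℕ → V × Decision A}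
    (h : ∀ c : G.Component W, G.Fulfils W C ρ c) :
    ∀ᶠ n in atTop, G.productRun W C ρ n ∈ (G.payoffAutomaton W C).accept := by
  have hc : ∀ c : G.Component W, ∀ᶠ n in atTop,
      c ∉ (G.productRun W C ρ n).2.2.1 ∧ c ∉ (G.productRun W C ρ n).2.2.2 := by
    intro c
    by_cases hs : c.IsSafety <;> by_cases hm : c.MustAccept
    · exact Eventually.of_forall fun n => ⟨fun h => h.1.2 hs, fun h => h.1.1 hm⟩
    · have := mt (h c).1 hm
      rw [(c.mem_language_iff C ρ).1 hs, not_forall] at this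
      obtain ⟨m, hm'⟩ := this
      filter_upwards [eventually_gt_atTop m] with n hn
      exact ⟨fun h => h.1.2 hs, fun h => hm' (h.2 m hn)⟩
    · obtain ⟨m, hm'⟩ := ((c.mem_language_iff C ρ).2 hs).1 ((h c).2 hm)
      filter_upwards [eventually_gt_atTop m] with n hn
      exact ⟨fun h => h.2 m hn hm', fun h => hs h.1.2⟩
    · exact Eventually.of_forall fun n => ⟨fun h => hm h.1.1, fun h => hs h.1.2⟩
  filter_upwards [eventually_all.2 hc] with n hn
  exact ⟨Set.eq_empty_iff_forall_notMem.2 fun c => (hn c).1,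
    Set.eq_empty_iff_forall_notMem.2 fun c => (hn c).2⟩

end Runs

/-! ### From an equilibrium to an accepted word -/

section Equilibrium

variable [Finite V] [∀ i, Finite (A i)] {G : Game V A} {W : G.Assignment} (C : G.Comparators)

/-- No agent can force a higher payoff by a deviation from the trace of a `W`-NE. -/
theorem IsWNE.inr_not_mem_win {π : G.Profile} (hπ : G.IsWNE W π)
    (j : {i : Fin k // (W i : ℕ) < (G.goal i).size}) (n : ℕ) :
    Sum.inr ((G.trace π n).1, (G.productRun W C (G.trace π) n).2.1 (Sum.inr j),
      (G.trace π n).2) ∉ (G.nextGame W C j).Win 1 := by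
  classical
  intro hwin
  have : Nonempty (Decision A) := ⟨(G.trace π 0).2⟩
  let M : DetBuchi (Weight (G.maxReward j.1)) := C.aut j.1 ((G.goal j.1).nth ⟨W j.1, j.2⟩)
  obtain ⟨g, hg⟩ := G.exists_profitable_reaction j.1 M (C.isComparator j.1 _)
  -- Agent `j` keeps her strategy for `n` rounds and then reacts to what the others play and to what
  -- she herself would have played.
  let s : G.Strategy j.1 := fun h v =>
    if h.length < n then π j.1 h v else g v (G.afterHistory j.1 M h) (fun i => π i h v)
  set π' : G.Profile := Function.update π j.1 s
  have hpre : ∀ m < n, G.trace π' m = G.trace π m :=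
    (G.isPlay_trace π').eq_of_snd_eq (G.isPlay_trace π) fun m hm heq hv => by
      funext i
      rw [trace_snd, trace_snd, map_range_congr heq, hv]
      by_cases hi : i = j.1
      · subst hi
        simp [π', s, hm]
      · simp [π', hi]
  let d : ℕ → Decision A := fun m i => π i ((List.range m).map (G.trace π')) (G.trace π' m).1
  have hn : (G.trace π' n).1 = (G.trace π n).1 :=
    (G.isPlay_trace π').fst_eq (G.isPlay_trace π) hpre
  have hd : d n = (G.trace π n).2 := by
    funext i
    rw [trace_snd, ← hn, ← map_range_congr hpre]
  have hlang := hg (G.trace π') n d (G.isPlay_trace π').2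
    (by rw [hn, hd, G.runOn_congr j.1 M hpre]; exact hwin)
    (fun m hm => by
      funext i
      rw [trace_snd]
      by_cases hi : i = j.1
      · subst hi
        simp only [π', Function.update_self, s, List.length_map, List.length_range,
          not_lt.2 hm, if_false, afterHistory_range, d]
      · simp [π', hi, d])
  have hlt := (C.mem_language_iff (G.trace π') j.1 ⟨W j.1, j.2⟩).1 hlang
  exact hπ.1 j.1 s (by rw [hπ.2]; exact hlt)

theorem IsWNE.language_nonempty {π : G.Profile} (hπ : G.IsWNE W π) :
    (G.equilibriumAutomaton W C).language.Nonempty := by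
  have hful := (G.forall_fulfils_iff W C (G.trace π)).2 hπ.2
  have hsafe : ∀ n, G.productRun W C (G.trace π) n ∈ G.safeStates W C := fun n j hj =>
    hπ.inr_not_mem_win C j n (G.inr_mem_win_of_inl_mem_win hj _)
  have hfin := G.finite_productState W C
  refine ⟨fun n => (G.trace π n).2, G.productRun W C (G.trace π),
    ⟨productRun_zero W C (G.isPlay_trace π), fun n => ⟨hsafe n, hsafe _, ?_,
      fun j => hπ.inr_not_mem_win C j n⟩⟩, ?_⟩
  · exact (trans_productRun_iff W C (G.isPlay_trace π) n _).2
      ⟨rfl, G.admissible_of_forall_fulfils W C hful n⟩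
  · exact (exists_frequently_eq_iff (G.productRun W C (G.trace π)) _).2
      (G.eventually_accept_of_forall_fulfils W C hful).frequently

end Equilibrium

/-! ### From an accepted word to an equilibrium -/

section Punishment

/-- The first pair of the history `h` that is not on `ρ` differs from `ρ` in the action of Agent `j`
and in no other action. -/
def IsDeviator (ρ : ℕ → V × Decision A) (h : List (V × Decision A)) (j : Fin k) : Prop :=
  ∃ n x, (∀ m < n, h[m]? = some (ρ m)) ∧ h[n]? = some x ∧ x.2 j ≠ (ρ n).2 j ∧
    ∀ i, i ≠ j → x.2 i = (ρ n).2 i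

theorem IsDeviator.unique {ρ : ℕ → V × Decision A} {h : List (V × Decision A)} {j j' : Fin k}
    (hj : IsDeviator ρ h j) (hj' : IsDeviator ρ h j') : j = j' := by
  obtain ⟨n, x, hpre, hx, hne, heq⟩ := hj
  obtain ⟨n', x', hpre', hx', hne', heq'⟩ := hj'
  rcases lt_trichotomy n n' with hlt | rfl | hlt
  · have := hpre' n hlt
    rw [hx, Option.some.injEq] at this
    exact (hne (by rw [this])).elim
  · rw [hx, Option.some.injEq] at hx'
    subst hx'
    by_contra hjj
    exact hne (heq' j hjj)
  · have := hpre n' hlt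
    rw [hx', Option.some.injEq] at this
    exact (hne' (by rw [this])).elim

theorem not_isDeviator_range (ρ : ℕ → V × Decision A) (n : ℕ) (j : Fin k) :
    ¬ IsDeviator ρ ((List.range n).map ρ) j := by
  rintro ⟨m, x, -, hx, hne, -⟩
  rw [List.getElem?_map, Option.map_eq_some_iff] at hx
  obtain ⟨a, ha, rfl⟩ := hx
  obtain ⟨hm, rfl⟩ := List.getElem?_eq_some_iff.1 ha
  exact hne (by simp)

theorem isDeviator_range {ρ ρ' : ℕ → V × Decision A} {n m : ℕ} (hnm : n < m)
    (hpre : ∀ l < n, ρ' l = ρ l) {j : Fin k} (hne : (ρ' n).2 ≠ (ρ n).2)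
    (heq : ∀ i, i ≠ j → (ρ' n).2 i = (ρ n).2 i) : IsDeviator ρ ((List.range m).map ρ') j := by
  refine ⟨n, ρ' n, fun l hl => ?_, by simp [hnm], fun h => hne ?_, heq⟩
  · simp [hl.trans hnm, hpre l hl]
  · funext i
    by_cases hi : i = j
    · rw [hi, h]
    · exact heq i hi

open Classical in
/-- The profile that follows `ρ` until some agent `j` leaves it, and then plays `σ j`. -/
noncomputable def punishingProfile (G : Game V A) (ρ : ℕ → V × Decision A)
    (σ : Fin k → List (V × Decision A) → V → Decision A) : G.Profile := fun i h v =>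
  if hj : ∃ j, IsDeviator ρ h j then σ hj.choose h v i else (ρ h.length).2 i

variable {G : Game V A} {ρ : ℕ → V × Decision A}
  {σ : Fin k → List (V × Decision A) → V → Decision A}

theorem punishingProfile_range (n : ℕ) (v : V) (i : Fin k) :
    G.punishingProfile ρ σ i ((List.range n).map ρ) v = (ρ n).2 i := by
  rw [punishingProfile, dif_neg fun ⟨j, hj⟩ => not_isDeviator_range ρ n j hj, List.length_map,
    List.length_range]

theorem punishingProfile_of_isDeviator {h : List (V × Decision A)} {j : Fin k}
    (hj : IsDeviator ρ h j) (v : V) (i : Fin k) :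
    G.punishingProfile ρ σ i h v = σ j h v i := by
  have hex : ∃ j, IsDeviator ρ h j := ⟨j, hj⟩
  rw [punishingProfile, dif_pos hex, hex.choose_spec.unique hj]

theorem trace_punishingProfile (hρ : G.IsPlay ρ) : G.trace (G.punishingProfile ρ σ) = ρ := by
  funext n
  refine (G.isPlay_trace _).eq_of_snd_eq hρ (n := n + 1) (fun m _ heq _ => ?_) n n.lt_succ_self
  funext i
  rw [trace_snd, map_range_congr heq, punishingProfile_range]

/-- A deviation of Agent `j` from the punishing profile has no effect, or from some time on it meets
the response `σ j` of the other agents. -/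
theorem trace_update_punishingProfile (hρ : G.IsPlay ρ) (j : Fin k) (s : G.Strategy j)
    (hne : G.trace (Function.update (G.punishingProfile ρ σ) j s) ≠ ρ) :
    ∃ n, (∀ m < n, G.trace (Function.update (G.punishingProfile ρ σ) j s) m = ρ m) ∧
      (∀ i, i ≠ j →
        (G.trace (Function.update (G.punishingProfile ρ σ) j s) n).2 i = (ρ n).2 i) ∧
      ∀ m, n < m → ∀ i, i ≠ j → (G.trace (Function.update (G.punishingProfile ρ σ) j s) m).2 i
        = σ j ((List.range m).map (G.trace (Function.update (G.punishingProfile ρ σ) j s)))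
          (G.trace (Function.update (G.punishingProfile ρ σ) j s) m).1 i := by
  classical
  set π' := Function.update (G.punishingProfile ρ σ) j s
  have hex : ∃ n, G.trace π' n ≠ ρ n := Function.ne_iff.1 hne
  set n := Nat.find hex
  have hpre : ∀ m < n, G.trace π' m = ρ m := fun m hm => not_not.1 (Nat.find_min hex hm)
  have hother : ∀ m, ∀ i, i ≠ j → (G.trace π' m).2 i
      = G.punishingProfile ρ σ i ((List.range m).map (G.trace π')) (G.trace π' m).1 :=
    fun m i hi => by
      rw [trace_snd]
      simp [π', hi]
  have hn : ∀ i, i ≠ j → (G.trace π' n).2 i = (ρ n).2 i := fun i hi => by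
    rw [hother n i hi, map_range_congr hpre, punishingProfile_range]
  have hd : (G.trace π' n).2 ≠ (ρ n).2 := fun h =>
    Nat.find_spec hex (Prod.ext ((G.isPlay_trace π').fst_eq hρ hpre) h)
  refine ⟨n, hpre, hn, fun m hm i hi => ?_⟩
  rw [hother m i hi, punishingProfile_of_isDeviator (isDeviator_range hm hpre hd hn)]

theorem exists_isWNE_of_language_nonempty [Finite V] [∀ i, Finite (A i)] {W : G.Assignment}
    (C : G.Comparators) (h : (G.equilibriumAutomaton W C).language.Nonempty) :
    ∃ π : G.Profile, G.IsWNE W π := by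
  obtain ⟨d, r, ⟨hr0, hr⟩, q, hq, hfreq⟩ := h
  have : Nonempty (Decision A) := ⟨d 0⟩
  obtain ⟨ρ, hρ, hρd, hrρ, hadm⟩ := exists_play_of_isRun W C (d := d) (r := r)
    ⟨hr0, fun n => (hr n).2.2.1⟩
  have hpay : ∀ i, G.payoff i ρ = W i := by
    obtain ⟨n, hn⟩ := hfreq.exists
    refine (G.forall_fulfils_iff W C ρ).1 (G.forall_fulfils_of_admissible W C hadm ⟨n, ?_⟩)
    rw [← hrρ, hn]
    exact hq
  have hnowin : ∀ (j : {i : Fin k // (W i : ℕ) < (G.goal i).size}) (n : ℕ),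
      Sum.inr ((ρ n).1, G.runOn j.1 (C.aut j.1 ((G.goal j.1).nth ⟨W j.1, j.2⟩)) ρ n, (ρ n).2) ∉
        (G.deviationGame j.1 (C.aut j.1 ((G.goal j.1).nth ⟨W j.1, j.2⟩))).Win 1 := fun j n => by
    have := (hr n).2.2.2 j
    rw [hrρ n, ← hρd n] at this
    exact this
  choose τ hτ using fun j : {i : Fin k // (W i : ℕ) < (G.goal i).size} =>
    G.exists_punishment j.1 (C.aut j.1 ((G.goal j.1).nth ⟨W j.1, j.2⟩)) (C.isComparator j.1 _)
  -- An agent with the maximal payoff need not be punished, so that any response to her will do.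
  let σ : Fin k → List (V × Decision A) → V → Decision A := fun j h v =>
    if hj : (W j : ℕ) < (G.goal j).size then τ ⟨j, hj⟩ v (G.afterHistory j _ h) else d 0
  refine ⟨G.punishingProfile ρ σ, fun j s hlt => ?_, fun i => ?_⟩
  · rw [trace_punishingProfile hρ, hpay] at hlt
    have hj : (W j : ℕ) < (G.goal j).size := hlt.trans_le ((G.goal j).payoff_le_size _)
    have hne : G.trace (Function.update (G.punishingProfile ρ σ) j s) ≠ ρ := fun h => by
      rw [h, hpay] at hlt
      exact lt_irrefl _ hlt
    obtain ⟨n, hpre, hn, hm⟩ := trace_update_punishingProfile hρ j s hne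
    refine hτ ⟨j, hj⟩ _ n (ρ n).2 (G.isPlay_trace _).2 ?_ hn (fun m hnm i hi => ?_)
      ((C.mem_language_iff _ j ⟨W j, hj⟩).2 hlt)
    · rw [(G.isPlay_trace _).fst_eq hρ hpre, G.runOn_congr _ _ hpre]
      exact hnowin ⟨j, hj⟩ n
    · rw [hm m hnm i hi]
      simp only [σ, hj, dif_pos, afterHistory_range]
  · rw [trace_punishingProfile hρ, hpay]

end Punishment

end Game

end MultiSat

/-- For a multi-satisficing game and a payoff assignment `W`: comparator automata for all thresholds
exist, and, whichever are used to build the automaton `A'_W`, its language is nonempty if and only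
if the game has a `W`-NE. -/
theorem theorem5 {V : Type*} [Finite V] {k : ℕ} {A : Fin k → Type*} [∀ i, Finite (A i)]
    (G : MultiSat.Game V A) (W : G.Assignment) :
    Nonempty G.Comparators ∧
      ∀ C : G.Comparators,
        (G.equilibriumAutomaton W C).language.Nonempty ↔ ∃ π : G.Profile, G.IsWNE W π := by
  refine ⟨?_, fun C => ⟨MultiSat.Game.exists_isWNE_of_language_nonempty C,
    fun ⟨_, hπ⟩ => hπ.language_nonempty C⟩⟩
  choose aut haut using fun i (m : Fin (G.goal i).size) => MultiSat.exists_isComparator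
    G.one_lt_discount (G.maxReward i) (G.goal i).rel ((G.goal i).threshold m)
  exact ⟨⟨aut, haut⟩⟩
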